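/- Let $s\ge 3$ and let $T^2_s$ be the theory, in the language $\{E\}$ of one binary relation, of the random (generic, Henson) $K_s$-free graph: it is axiomatized by saying that $E$ is a simple graph without complete subgraph on $s$ vertices and that, for all disjoint finite sets of vertices $A,B$ such that $A$ contains no complete subgraph on $s-1$ vertices, there is a vertex outside $B$ that is adjacent to every vertex of $A$ and to no vertex of $B$. Let $\kappa>\aleph_0$ and let $\mathcal U\models T^2_s$ be $\kappa$-saturated; "small" means of cardinality $<\kappa$. A type $p\in S_n(\mathcal U)$ is *sequentially approximated over* $M\prec\mathcal U$ if there are $a_0,a_1,\dots\in M^n$ with $\lim_i\operatorname{tp}(a_i/\mathcal U)=p$ in the Stone space $S_n(\mathcal U)$. A Keisler measure $\mu\in\mathfrak M_n(\mathcal U)$ (a finitely additive probability measure on the formulas in $n$ variables with parameters from $\mathcal U$, modulo equivalence; the space $\mathfrak M_n(\mathcal U)$ carries the topology of pointwise convergence) is *sequentially approximated over* $M$ if there are non-empty finite sequences $\bar a_0,\bar a_1,\dots$ of elements of $M^n$ whose average measures $\operatorname{Av}(\bar a_i)$ converge to $\mu$. It is *finitely approximated over* $M$ if for every formula $\varphi(x,y)$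 without parameters and every $\epsilon>0$ there is a non-empty finite sequence $\bar a$ of elements of $M^n$ with $|\mu(\varphi(x,b))-\operatorname{Av}(\bar a)(\varphi(x,b))|<\epsilon$ for all tuples $b$ from $\mathcal U$. Each notion without "over $M$" means "over some small $M\prec\mathcal U$". Then there is a unique global type $p_*\in S_1(\mathcal U)$ containing $\{\neg E(x,b):b\in\mathcal U\}$. Its Dirac measure $\delta_{p_*}$ is finitely approximated, even over every elementary submodel $M\prec\mathcal U$, and $\delta_{p_*}$ is sequentially approximated, but $p_*$ is not sequentially approximated. Moreover, for every $n$, no type $p\in S_n(\mathcal U)$ that is not realized by a tuple of $\mathcal U$ is sequentially approximated. -/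

import Mathlib

open FirstOrder FirstOrder.Language Filter Topology Cardinal

namespace KeislerMeasures

universe u v w

section General

variable (L : FirstOrder.Language.{u, v}) (U : Type w) [L.Structure U]

/-- `U` is `κ`-saturated: every set of formulas in one variable, with parameters from a set `A` of
cardinality `< κ`, that is finitely satisfiable in `U` is realized in `U`. -/
def IsSaturated (κ : Cardinal.{w}) : Prop :=
  ∀ A : Set U, #A < κ → ∀ Γ : Set (L[[A]].Formula (Fin 1)),
    (∀ Γ₀ : Finset (L[[A]].Formula (Fin 1)), (Γ₀ : Set (L[[A]].Formula (Fin 1))) ⊆ Γ →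
      ∃ a : Fin 1 → U, ∀ φ ∈ Γ₀, φ.Realize a) →
    ∃ a : Fin 1 → U, ∀ φ ∈ Γ, φ.Realize a

/-- The space `S_n(U)` of complete types over `U` in `n` variables, with its Stone topology. -/
abbrev GlobalType (n : ℕ) : Type (max u v w) :=
  (L.elementaryDiagram U).CompleteType (Fin n)

variable {L U}

/-- The formula `φ(x)`, with parameters from `U`, belongs to the type `p(x)`. -/
def GlobalType.Contains {n : ℕ} (p : GlobalType L U n) (φ : L[[U]].Formula (Fin n)) : Prop :=
  Formula.equivSentence φ ∈ p

/-- The formula `φ(x, b)`, with parameters from `U`, for a partitioned formula `φ(x, y)`. -/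
def instParams {n k : ℕ} (φ : L.Formula (Fin n ⊕ Fin k)) (b : Fin k → U) :
    L[[U]].Formula (Fin n) :=
  BoundedFormula.subst ((L.lhomWithConstants U).onFormula φ)
    (Sum.elim Term.var fun j => Constants.term (L.con (b j)))

theorem realize_instParams {n k : ℕ} (φ : L.Formula (Fin n ⊕ Fin k)) (b : Fin k → U)
    (a : Fin n → U) : (instParams φ b).Realize a ↔ φ.Realize (Sum.elim a b) := by
  unfold instParams Formula.Realize
  rw [BoundedFormula.realize_subst]
  have : (fun i : Fin n ⊕ Fin k => Term.realize a
      (Sum.elim Term.var (fun j => Constants.term (L.con (b j))) i : L[[U]].Term (Fin n)))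
      = Sum.elim a b := by
    funext i
    cases i with
    | inl i => rfl
    | inr j => exact (Term.realize_constants).trans (by simp; rfl)
  rw [this]
  exact LHom.realize_onFormula _ _

section Types

variable [Nonempty U]

/-- The type `tp(a/U)` of a tuple `a` from `U`. -/
def tp {n : ℕ} (a : Fin n → U) : GlobalType L U n :=
  (L.elementaryDiagram U).typeOf a

/-- `p` is realized: it is the type over `U` of a tuple from `U`. -/
def GlobalType.IsRealized {n : ℕ} (p : GlobalType L U n) : Prop :=
  ∃ a : Fin n → U, p = tp a

/-- `p` is the limit in `S_n(U)` of a sequence of types of tuples from `M`. -/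
def GlobalType.IsSequentiallyApproximatedOver {n : ℕ} (p : GlobalType L U n)
    (M : L.ElementarySubstructure U) : Prop :=
  ∃ a : ℕ → Fin n → U, (∀ i j, a i j ∈ M) ∧ Tendsto (fun i => tp (L := L) (a i)) atTop (𝓝 p)

/-- `p` is sequentially approximated over some small (that is, of cardinality `< κ`) elementary
submodel. -/
def GlobalType.IsSequentiallyApproximated (κ : Cardinal.{w}) {n : ℕ} (p : GlobalType L U n) :
    Prop :=
  ∃ M : L.ElementarySubstructure U, #M < κ ∧ p.IsSequentiallyApproximatedOver M

end Types

theorem GlobalType.exists_realize {n : ℕ} (p : GlobalType L U n) :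
    ∃ (N : Theory.ModelType.{max u w, v, max u v w} (L.elementaryDiagram U)) (v : Fin n → N),
      ∀ φ : L[[U]].Formula (Fin n), p.Contains φ ↔ φ.Realize v := by
  obtain ⟨N, v, rfl⟩ := Theory.exists_modelType_is_realized_in (T := L.elementaryDiagram U) p
  exact ⟨N, v, fun φ => Theory.CompleteType.formula_mem_typeOf⟩

theorem realize_of_forall {n : ℕ} (N : Theory.ModelType.{max u w, v, max u v w} (L.elementaryDiagram U)) (v : Fin n → N)
    (φ : L[[U]].Formula (Fin n)) (h : ∀ a : Fin n → U, φ.Realize a) : φ.Realize v := by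
  have hmem : Formula.iAlls (Fin n) (φ.relabel (Sum.inr : Fin n → Empty ⊕ Fin n)) ∈
      L.elementaryDiagram U := by
    show U ⊨ Formula.iAlls (Fin n) (φ.relabel (Sum.inr : Fin n → Empty ⊕ Fin n))
    simp only [Sentence.Realize, Formula.realize_iAlls, Formula.realize_relabel]
    exact fun a => h a
  have := N.is_model.realize_of_mem _ hmem
  simp only [Sentence.Realize, Formula.realize_iAlls, Formula.realize_relabel] at this
  exact this v

variable (L U) in
/-- Keisler measures: finitely additive probability measures on the formulas in `n` variables with
parameters from `U`, modulo equivalence in `U`. -/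
structure KeislerMeasure (n : ℕ) where
  toFun : L[[U]].Formula (Fin n) → ℝ
  nonneg' : ∀ φ, 0 ≤ toFun φ
  top' : toFun ⊤ = 1
  congr' : ∀ φ ψ : L[[U]].Formula (Fin n),
    (∀ a : Fin n → U, φ.Realize a ↔ ψ.Realize a) → toFun φ = toFun ψ
  add' : ∀ φ ψ : L[[U]].Formula (Fin n),
    (∀ a : Fin n → U, ¬ (φ.Realize a ∧ ψ.Realize a)) → toFun (φ ⊔ ψ) = toFun φ + toFun ψ

instance {n : ℕ} : CoeFun (KeislerMeasure L U n) fun _ => L[[U]].Formula (Fin n) → ℝ :=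
  ⟨KeislerMeasure.toFun⟩

/-- The topology induced from the product topology on the functions from formulas to `ℝ`. -/
instance {n : ℕ} : TopologicalSpace (KeislerMeasure L U n) :=
  TopologicalSpace.induced KeislerMeasure.toFun inferInstance

open scoped Classical in
/-- The Dirac measure `δ_p` at a global type `p`. -/
noncomputable def dirac {n : ℕ} (p : GlobalType L U n) : KeislerMeasure L U n where
  toFun φ := if p.Contains φ then 1 else 0
  nonneg' φ := by split_ifs <;> norm_num
  top' := by
    obtain ⟨N, v, h⟩ := p.exists_realize
    rw [if_pos ((h ⊤).2 (by simp [Formula.Realize]))]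
  congr' φ ψ hφψ := by
    obtain ⟨N, v, h⟩ := p.exists_realize
    have := realize_of_forall N v (φ.iff ψ) (by simpa using hφψ)
    simp only [Formula.realize_iff] at this
    simp only [h, this]
  add' φ ψ hφψ := by
    obtain ⟨N, v, h⟩ := p.exists_realize
    have := realize_of_forall N v (φ ⊓ ψ).not
      (by simpa only [Formula.realize_not, Formula.realize_inf] using hφψ)
    simp only [Formula.realize_not, Formula.realize_inf] at this
    simp only [h, Formula.realize_sup]
    by_cases h1 : φ.Realize v <;> by_cases h2 : ψ.Realize v <;> simp_all

open scoped Classical in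
/-- The average measure `Av(a)` of a non-empty finite sequence of tuples from `U`. -/
noncomputable def average {n m : ℕ} (a : Fin (m + 1) → Fin n → U) : KeislerMeasure L U n where
  toFun φ := ((Finset.univ.filter fun i => φ.Realize (a i)).card : ℝ) / ((m + 1 : ℕ) : ℝ)
  nonneg' φ := by positivity
  top' := by
    have : (Finset.univ.filter fun i => (⊤ : L[[U]].Formula (Fin n)).Realize (a i)) =
        Finset.univ := by
      ext i
      simp [Formula.Realize]
    rw [this, Finset.card_univ, Fintype.card_fin]
    exact div_self (by positivity)
  congr' φ ψ h := by simp only [h]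
  add' φ ψ h := by
    rw [← add_div, ← Nat.cast_add, ← Finset.card_union_of_disjoint]
    · rw [← Finset.filter_or]
      simp only [Formula.realize_sup]
    · rw [Finset.disjoint_filter]
      exact fun i _ h1 h2 => h (a i) ⟨h1, h2⟩

/-- `μ` is finitely approximated over `M`. -/
def KeislerMeasure.IsFinitelyApproximatedOver {n : ℕ} (μ : KeislerMeasure L U n)
    (M : L.ElementarySubstructure U) : Prop :=
  ∀ (k : ℕ) (φ : L.Formula (Fin n ⊕ Fin k)) (ε : ℝ), 0 < ε →
    ∃ (m : ℕ) (a : Fin (m + 1) → Fin n → U), (∀ i j, a i j ∈ M) ∧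
      ∀ b : Fin k → U, |μ (instParams φ b) - average (L := L) a (instParams φ b)| < ε

/-- `μ` is finitely approximated over some small elementary submodel. -/
def KeislerMeasure.IsFinitelyApproximated (κ : Cardinal.{w}) {n : ℕ}
    (μ : KeislerMeasure L U n) : Prop :=
  ∃ M : L.ElementarySubstructure U, #M < κ ∧ μ.IsFinitelyApproximatedOver M

/-- `μ` is the limit of a sequence of average measures of finite sequences of tuples from `M`. -/
def KeislerMeasure.IsSequentiallyApproximatedOver {n : ℕ} (μ : KeislerMeasure L U n)
    (M : L.ElementarySubstructure U) : Prop :=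
  ∃ (m : ℕ → ℕ) (a : ∀ t : ℕ, Fin (m t + 1) → Fin n → U), (∀ t i j, a t i j ∈ M) ∧
    Tendsto (fun t => average (L := L) (a t)) atTop (𝓝 μ)

/-- `μ` is sequentially approximated over some small elementary submodel. -/
def KeislerMeasure.IsSequentiallyApproximated (κ : Cardinal.{w}) {n : ℕ}
    (μ : KeislerMeasure L U n) : Prop :=
  ∃ M : L.ElementarySubstructure U, #M < κ ∧ μ.IsSequentiallyApproximatedOver M

end General

section Graph

/-- The formula `E(x_i, x_j)`. -/
def adjFormula {α : Type} (i j : α) : Language.graph.Formula α :=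
  adj.formula₂ (Term.var i) (Term.var j)

/-- The formula `x_i = x_j`. -/
def eqFormula {α : Type} (i j : α) : Language.graph.Formula α :=
  Term.equal (Term.var i) (Term.var j)

/-- The formula saying that the `x_{σ 0}, …, x_{σ (r - 1)}` are pairwise adjacent. -/
noncomputable def cliqueFormula {α : Type} {r : ℕ} (σ : Fin r → α) : Language.graph.Formula α :=
  Formula.iInf fun ij : {ij : Fin r × Fin r // ij.1 ≠ ij.2} =>
    adjFormula (σ ij.1.1) (σ ij.1.2)

/-- The sentence saying that there is no complete subgraph on `s` vertices. -/
noncomputable def cliqueFreeSentence (s : ℕ) : Language.graph.Sentence :=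
  Formula.iAlls (Fin s) (cliqueFormula (Sum.inr : Fin s → Empty ⊕ Fin s)).not

/-- The formula in `x_0, …, x_{k-1}, y_0, …, y_{l-1}` saying that no `x_i` equals any `y_j` and that
the `x_i` contain no complete graph on `r` vertices. -/
noncomputable def admissibleFormula (r k l : ℕ) : Language.graph.Formula (Fin k ⊕ Fin l) :=
  (Formula.iInf fun σ : Fin r → Fin k => (cliqueFormula (Sum.inl ∘ σ)).not) ⊓
    Formula.iInf fun ij : Fin k × Fin l => (eqFormula (Sum.inl ij.1) (Sum.inr ij.2)).not

/-- The formula in `x_0, …, x_{k-1}, y_0, …, y_{l-1}` and `z` saying that `z` is adjacent to every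
`x_i`, and is distinct from and not adjacent to every `y_j`. -/
noncomputable def extendsFormula (k l : ℕ) :
    Language.graph.Formula ((Fin k ⊕ Fin l) ⊕ Fin 1) :=
  (Formula.iInf fun i : Fin k => adjFormula (Sum.inr 0) (Sum.inl (Sum.inl i))) ⊓
    Formula.iInf fun j : Fin l => (adjFormula (Sum.inr 0) (Sum.inl (Sum.inr j))).not ⊓
      (eqFormula (Sum.inr 0) (Sum.inl (Sum.inr j))).not

/-- The extension axiom: for all disjoint `{x_0, …, x_{k-1}}` and `{y_0, …, y_{l-1}}` such that the
first contains no complete graph on `s - 1` vertices, there is a `z` adjacent to every `x_i`, and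
distinct from and not adjacent to every `y_j`. -/
noncomputable def extensionSentence (s k l : ℕ) : Language.graph.Sentence :=
  Formula.iAlls (Fin k ⊕ Fin l)
    (((admissibleFormula (s - 1) k l).imp (Formula.iExs (Fin 1) (extendsFormula k l))).relabel
      (Sum.inr : Fin k ⊕ Fin l → Empty ⊕ (Fin k ⊕ Fin l)))

/-- The theory of the random (generic, Henson) `K_s`-free graph, for `s ≥ 3`: simple graphs
without a complete subgraph on `s` vertices that satisfy all extension axioms. -/
noncomputable def randomCliqueFreeGraph (s : ℕ) : Language.graph.Theory :=
  Theory.simpleGraph ∪ {cliqueFreeSentence s} ∪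
    Set.range fun kl : ℕ × ℕ => extensionSentence s kl.1 kl.2

/-- The formula `¬ E(x, b)`. -/
def notAdj {U : Type w} [Language.graph.Structure U] (b : U) :
    Language.graph[[U]].Formula (Fin 1) :=
  instParams (adjFormula (Sum.inl 0) (Sum.inr 0) : Language.graph.Formula (Fin 1 ⊕ Fin 1)).not
    fun _ => b

end Graph

end KeislerMeasures

/-!
Let `k = s - 1`. A model of the theory is a generic `K_{k+1}`-free graph in the sense of
`IsGenericCliqueFree`, and there, by back-and-forth, tuples that satisfy the same atomic formulas
satisfy the same formulas (`IsGenericCliqueFree.realize_iff`). So the vertices that are apart from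
`b` (neither in `b` nor adjacent to it) all have the same type over `b`. This determines every type
containing all `¬ E(x, b)`, since `x ≠ b` follows from `¬ E(x, c)` for a neighbour `c` of `b`. Such
a type `p` exists by compactness of the type space.

The Dirac measure of `p` is approximated by the average of vertices `a 0, …, a m` as soon as every
closed neighbourhood contains few of them: for a formula with `l` parameters the error is at most
`l` times the density of a closed neighbourhood (`abs_dirac_sub_average_le`). Neighbourhoods are
`k`-clique-free, so finite `K_{k+1}`-free graphs are needed in which all `k`-clique-free sets have
small density, as in a theorem of Erdős and Rogers. They embed into every elementary submodel. For
their existence (`HasSparseWeights`) a probabilistic construction is avoided: if there were none for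
some density `ε`, then by Hahn–Banach separation (`exists_positive_functional`) there would be a
finitely additive random `k`-clique-free set of vertices that contains every vertex with probability
at least `ε`, and `HasSparseWeights.succ` refutes this by an exhaustion argument, using the sparse
graphs for `k - 1`.

If types of tuples `a 0, a 1, …` converge, then for each coordinate the truth values of `x = b` and
`E(x, b)` along the sequence converge. A coordinate that is not eventually constant would contain an
infinite clique or an infinite independent sequence of distinct vertices. The former does not exist,
and the latter is split into two infinite halves by the neighbourhood of some vertex, by saturation
(`exists_adj_iff_of_independent`). So the sequence is eventually constant and the limit is realized.
-/

namespace KeislerMeasures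

/-! ### Cliques and generic clique-free graphs -/

section Combinatorics

open scoped Classical in
theorem cliqueFreeOn_iff_forall_fun {V : Type*} {G : SimpleGraph V} {S : Set V} {k : ℕ} :
    G.CliqueFreeOn S k ↔
      ∀ f : Fin k → V, (∀ i, f i ∈ S) → ¬ ∀ i j, i ≠ j → G.Adj (f i) (f j) := by
  constructor
  · intro h f hf hadj
    have hinj : Function.Injective f := fun i j hij => by
      by_contra hne
      exact G.irrefl (hij ▸ hadj i j hne)
    refine h (t := Finset.univ.image f) ?_ ⟨?_, ?_⟩
    · intro x hx
      simp only [Finset.coe_image, Finset.coe_univ, Set.image_univ, Set.mem_range] at hx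
      obtain ⟨i, rfl⟩ := hx
      exact hf i
    · intro x hx y hy hxy
      simp only [Finset.coe_image, Finset.coe_univ, Set.image_univ, Set.mem_range] at hx hy
      obtain ⟨i, rfl⟩ := hx
      obtain ⟨j, rfl⟩ := hy
      exact hadj i j fun h => hxy (h ▸ rfl)
    · rw [Finset.card_image_of_injective _ hinj, Finset.card_univ, Fintype.card_fin]
  · intro h t hts ht
    let e := t.equivFinOfCardEq ht.card_eq
    refine h (fun i => (e.symm i : V)) (fun i => hts (e.symm i).2) fun i j hij => ?_
    exact ht.isClique (e.symm i).2 (e.symm j).2 fun h => hij (e.symm.injective (Subtype.ext h))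

theorem cliqueFree_iff_forall_fun {V : Type*} {G : SimpleGraph V} {k : ℕ} :
    G.CliqueFree k ↔ ∀ f : Fin k → V, ¬ ∀ i j, i ≠ j → G.Adj (f i) (f j) := by
  rw [← SimpleGraph.cliqueFreeOn_univ, cliqueFreeOn_iff_forall_fun]
  simp

theorem cliqueFree_comap {V W : Type*} {G : SimpleGraph V} {k : ℕ} (h : G.CliqueFree k)
    (f : W → V) : (G.comap f).CliqueFree k := by
  rw [cliqueFree_iff_forall_fun] at h ⊢
  exact fun g hg => h (f ∘ g) hg

theorem cliqueFreeOn_image {V W : Type*} {G : SimpleGraph V} {H : SimpleGraph W} {k : ℕ}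
    {S : Set W} (h : H.CliqueFreeOn S k) (f : W → V)
    (hf : ∀ x ∈ S, ∀ y ∈ S, G.Adj (f x) (f y) → H.Adj x y) : G.CliqueFreeOn (f '' S) k := by
  rw [cliqueFreeOn_iff_forall_fun] at h ⊢
  intro g hg hadj
  choose g' hg' hgg using hg
  refine h g' hg' fun i j hij => hf _ (hg' i) _ (hg' j) ?_
  rw [hgg, hgg]
  exact hadj i j hij

/-- A clique in a union of two sets without edges between them lies in one of the two. -/
theorem cliqueFreeOn_union {V : Type*} {G : SimpleGraph V} {k : ℕ} {S T : Set V}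
    (hS : G.CliqueFreeOn S k) (hT : G.CliqueFreeOn T k)
    (hST : ∀ a ∈ S, ∀ b ∈ T, ¬ G.Adj a b) : G.CliqueFreeOn (S ∪ T) k := by
  intro t ht hc
  by_cases h1 : (t : Set V) ⊆ S
  · exact hS h1 hc
  by_cases h2 : (t : Set V) ⊆ T
  · exact hT h2 hc
  obtain ⟨b, hb, hbS⟩ := Set.not_subset.1 h1
  obtain ⟨a, ha, haT⟩ := Set.not_subset.1 h2
  have haS := (ht ha).resolve_right haT
  have hbT := (ht hb).resolve_left hbS
  exact hST a haS b hbT (hc.isClique ha hb fun h => hbS (h ▸ haS))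

open scoped Classical in
theorem cliqueFreeOn_insert {V : Type*} {G : SimpleGraph V} {k : ℕ} {S : Set V}
    (hS : G.CliqueFreeOn S k) (c : V) : G.CliqueFreeOn (insert c S) (k + 1) := by
  intro t ht hc
  by_cases h : c ∈ t
  · refine hS (t := t.erase c) ?_ ⟨hc.isClique.subset (by simp), ?_⟩
    · intro x hx
      simp only [Finset.coe_erase, Set.mem_sdiff, Finset.mem_coe, Set.mem_singleton_iff] at hx
      exact (ht hx.1).resolve_left hx.2
    · rw [Finset.card_erase_of_mem h, hc.card_eq, Nat.add_sub_cancel]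
  · exact SimpleGraph.CliqueFreeOn.mono _ (Nat.le_succ k) hS
      (fun x hx => (ht hx).resolve_left fun hxc => h (hxc ▸ hx)) hc

/-- A set of neighbours of `z` is free of `k`-cliques, since `z` would extend them. -/
theorem cliqueFreeOn_of_forall_adj {V : Type*} {G : SimpleGraph V} {k : ℕ}
    (hG : G.CliqueFree (k + 1)) {S : Set V} {z : V} (hz : ∀ a ∈ S, G.Adj z a) :
    G.CliqueFreeOn S k :=
  (SimpleGraph.CliqueFreeOn.of_succ G (hG.cliqueFreeOn (s := Set.univ)) (Set.mem_univ z)).subset G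
    (Set.subset_inter (Set.subset_univ S) hz)

/-- `G` is a generic `K_{k+1}`-free graph: a `K_{k+1}`-free graph such that for all disjoint
finite `A` and `B` with `A` free of `k`-cliques there is a vertex outside `B` that is adjacent to
all of `A` and to nothing in `B`. -/
structure IsGenericCliqueFree {V : Type*} (G : SimpleGraph V) (k : ℕ) : Prop where
  cliqueFree : G.CliqueFree (k + 1)
  exists_adj : ∀ A B : Finset V, Disjoint A B → G.CliqueFreeOn A k →
    ∃ z ∉ B, (∀ a ∈ A, G.Adj z a) ∧ ∀ b ∈ B, ¬ G.Adj z b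

theorem IsGenericCliqueFree.exists_adj_self {V : Type*} {G : SimpleGraph V} {k : ℕ}
    (hG : IsGenericCliqueFree G k) (hk : 2 ≤ k) (b : V) :
    ∃ c, G.Adj b c := by
  obtain ⟨c, -, hc, -⟩ := hG.exists_adj {b} ∅ (by simp) (by simpa using by omega)
  exact ⟨c, (hc b (by simp)).symm⟩

theorem IsGenericCliqueFree.infinite {V : Type*} {G : SimpleGraph V} {k : ℕ}
    (hG : IsGenericCliqueFree G k) (hk : 1 ≤ k) :
    Infinite V := by
  refine ⟨fun h => ?_⟩
  have := Fintype.ofFinite V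
  obtain ⟨z, hz, -⟩ := hG.exists_adj ∅ Finset.univ (by simp) (by simpa using by omega)
  exact hz (Finset.mem_univ z)

theorem IsGenericCliqueFree.exists_apart {V : Type*} {G : SimpleGraph V} {k : ℕ}
    (hG : IsGenericCliqueFree G k) (hk : 1 ≤ k)
    (B : Finset V) : ∃ a, ∀ b ∈ B, a ≠ b ∧ ¬ G.Adj a b := by
  obtain ⟨z, hz, -, hzB⟩ := hG.exists_adj ∅ B (by simp) (by simpa using by omega)
  exact ⟨z, fun b hb => ⟨fun h => hz (h ▸ hb), hzB b hb⟩⟩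

open scoped Classical in
/-- The neighbourhood of a vertex in a generic `K_{k+2}`-free graph is a generic `K_{k+1}`-free
graph. -/
theorem IsGenericCliqueFree.induce_neighborSet {V : Type*} {G : SimpleGraph V} {k : ℕ}
    (hG : IsGenericCliqueFree G (k + 1)) (c : V) :
    IsGenericCliqueFree (G.induce (G.neighborSet c)) k where
  cliqueFree := by
    rw [SimpleGraph.cliqueFree_induce_iff]
    exact cliqueFreeOn_of_forall_adj hG.cliqueFree fun a ha => ha
  exists_adj A B hAB hA := by
    have hA' : G.CliqueFreeOn (Subtype.val '' (A : Set (G.neighborSet c))) k :=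
      cliqueFreeOn_image hA _ fun x _ y _ h => h
    obtain ⟨z, hzB, hzA, hzB'⟩ := hG.exists_adj (insert c (A.image Subtype.val))
      (B.image Subtype.val) (by
        rw [Finset.disjoint_insert_left]
        refine ⟨?_, (Finset.disjoint_image Subtype.val_injective).2 hAB⟩
        simp) (by
        rw [Finset.coe_insert, Finset.coe_image]
        exact cliqueFreeOn_insert hA' c)
    have hzc : G.Adj c z := (hzA c (Finset.mem_insert_self _ _)).symm
    refine ⟨⟨z, hzc⟩, fun h => hzB (Finset.mem_image_of_mem _ h), fun a ha => ?_, fun b hb => ?_⟩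
    · exact hzA a (Finset.mem_insert_of_mem (Finset.mem_image_of_mem _ ha))
    · exact hzB' b (Finset.mem_image_of_mem _ hb)

open scoped Classical in
/-- A finite `K_{k+1}`-free graph `H` embeds into a generic `K_{k+1}`-free graph `G`, away from a
given finite set `F`. Moreover, the image `w i` of each vertex can be chosen adjacent to all of a
`k`-clique-free set `I i` that is picked from a supply `R` of such sets, in which sets that are
apart from any given finite set can be found. -/
theorem IsGenericCliqueFree.exists_embedding {V : Type*} {G : SimpleGraph V} {k : ℕ}
    (hG : IsGenericCliqueFree G k) (R : Finset V → Prop)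
    (hR : ∀ F : Finset V, ∃ I : Finset V, R I ∧ G.CliqueFreeOn I k ∧
      ∀ a ∈ I, ∀ b ∈ F, a ≠ b ∧ ¬ G.Adj a b)
    {ι : Type*} [Finite ι] (H : SimpleGraph ι) (hH : H.CliqueFree (k + 1)) (F : Finset V) :
    ∃ (w : ι → V) (I : ι → Finset V), Function.Injective w ∧
      (∀ i j, G.Adj (w i) (w j) ↔ H.Adj i j) ∧
      ∀ i, R (I i) ∧ G.CliqueFreeOn (I i) k ∧ (∀ a ∈ I i, G.Adj (w i) a) ∧
        (∀ a ∈ I i, ∀ b ∈ F, a ≠ b ∧ ¬ G.Adj a b) ∧ ∀ b ∈ F, w i ≠ b ∧ ¬ G.Adj (w i) b := by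
  have := Fintype.ofFinite ι
  suffices h : ∀ T : Finset ι, ∃ (w : ι → V) (I : ι → Finset V),
      (∀ i ∈ T, ∀ j ∈ T, (w i = w j → i = j) ∧ (G.Adj (w i) (w j) ↔ H.Adj i j)) ∧
      ∀ i ∈ T, R (I i) ∧ G.CliqueFreeOn (I i) k ∧ (∀ a ∈ I i, G.Adj (w i) a) ∧
        (∀ a ∈ I i, ∀ b ∈ F, a ≠ b ∧ ¬ G.Adj a b) ∧ ∀ b ∈ F, w i ≠ b ∧ ¬ G.Adj (w i) b by
    obtain ⟨w, I, h1, h2⟩ := h Finset.univ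
    exact ⟨w, I, fun i j => (h1 i (Finset.mem_univ _) j (Finset.mem_univ _)).1,
      fun i j => (h1 i (Finset.mem_univ _) j (Finset.mem_univ _)).2,
      fun i => h2 i (Finset.mem_univ _)⟩
  intro T
  induction T using Finset.induction_on with
  | empty =>
    obtain ⟨z, -⟩ : ∃ z : V, True := by
      rcases k with _ | k
      · obtain ⟨I, -, hI, -⟩ := hR ∅
        exact (hI (Finset.coe_subset.2 (Finset.empty_subset _)) (by simp)).elim
      · obtain ⟨z, -⟩ := hG.exists_adj ∅ ∅ (by simp) (by simp)
        exact ⟨z, trivial⟩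
    exact ⟨fun _ => z, fun _ => ∅, by simp, by simp⟩
  | insert x T hx ih =>
    obtain ⟨w, I, h1, h2⟩ := ih
    obtain ⟨J, hJR, hJ, hJF⟩ := hR (F ∪ T.image w)
    -- there are no edges between `J` and the vertices chosen before, so `z` can be adjacent to both
    have hcf : G.CliqueFreeOn (↑(J ∪ (T.filter (H.Adj x)).image w)) k := by
      have hTx : G.CliqueFreeOn (w '' (↑(T.filter (H.Adj x)) : Set ι)) k := by
        refine cliqueFreeOn_image (H := H) ?_ w fun i hi j hj h => ?_
        · exact cliqueFreeOn_of_forall_adj hH (z := x) fun a ha => (Finset.mem_filter.1 ha).2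
        · exact (h1 i (Finset.mem_filter.1 hi).1 j (Finset.mem_filter.1 hj).1).2.1 h
      rw [Finset.coe_union, Finset.coe_image]
      refine cliqueFreeOn_union hJ hTx ?_
      rintro a ha _ ⟨i, hi, rfl⟩
      exact (hJF a ha _ (Finset.mem_union_right _
        (Finset.mem_image_of_mem _ (Finset.mem_filter.1 hi).1))).2
    obtain ⟨z, hzB, hzA, hzB'⟩ := hG.exists_adj (J ∪ (T.filter (H.Adj x)).image w)
      (F ∪ (T.filter fun i => ¬ H.Adj x i).image w) (by
        rw [Finset.disjoint_left]
        intro a ha hb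
        rcases Finset.mem_union.1 ha with ha | ha
        · refine (hJF a ha a ?_).1 rfl
          exact Finset.union_subset_union_right
            (Finset.image_subset_image (Finset.filter_subset _ _)) hb
        · obtain ⟨i, hi, rfl⟩ := Finset.mem_image.1 ha
          obtain ⟨hi, hxi⟩ := Finset.mem_filter.1 hi
          rcases Finset.mem_union.1 hb with hb | hb
          · exact ((h2 i hi).2.2.2.2 _ hb).1 rfl
          · obtain ⟨j, hj, hji⟩ := Finset.mem_image.1 hb
            obtain ⟨hj, hxj⟩ := Finset.mem_filter.1 hj
            exact hxj ((h1 j hj i hi).1 hji ▸ hxi)) hcf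
    have hzw : ∀ i ∈ T, z ≠ w i ∧ (G.Adj z (w i) ↔ H.Adj x i) := by
      intro i hi
      by_cases hxi : H.Adj x i
      · have hadj := hzA (w i) (Finset.mem_union_right _
          (Finset.mem_image_of_mem _ (Finset.mem_filter.2 ⟨hi, hxi⟩)))
        exact ⟨hadj.ne, iff_of_true hadj hxi⟩
      · have hm := Finset.mem_union_right F
          (Finset.mem_image_of_mem w
          (Finset.mem_filter (p := fun i => ¬ H.Adj x i).2 ⟨hi, hxi⟩))
        exact ⟨fun h => hzB (h ▸ hm), iff_of_false (hzB' _ hm) hxi⟩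
    have hne : ∀ i ∈ T, i ≠ x := fun i hi h => hx (h ▸ hi)
    refine ⟨Function.update w x z, Function.update I x J, ?_, ?_⟩
    · intro i hi j hj
      rcases Finset.mem_insert.1 hi with hix | hi' <;> rcases Finset.mem_insert.1 hj with hjx | hj'
      · subst hix hjx
        simp
      · subst hix
        rw [Function.update_self, Function.update_of_ne (hne j hj')]
        exact ⟨fun h => absurd h (hzw j hj').1, (hzw j hj').2⟩
      · subst hjx
        rw [Function.update_self, Function.update_of_ne (hne i hi')]
        refine ⟨fun h => absurd h.symm (hzw i hi').1, ?_⟩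
        rw [G.adj_comm, H.adj_comm]
        exact (hzw i hi').2
      · rw [Function.update_of_ne (hne i hi'), Function.update_of_ne (hne j hj')]
        exact h1 i hi' j hj'
    · intro i hi
      rcases Finset.mem_insert.1 hi with rfl | hi
      · simp only [Function.update_self]
        refine ⟨hJR, hJ, fun a ha => hzA a (Finset.mem_union_left _ ha), fun a ha b hb =>
          hJF a ha b (Finset.mem_union_left _ hb), fun b hb => ?_⟩
        exact ⟨fun h => hzB (h ▸ Finset.mem_union_left _ hb), hzB' b (Finset.mem_union_left _ hb)⟩
      · simp only [Function.update_of_ne (hne i hi)]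
        exact h2 i hi

end Combinatorics

/-! ### Finite graphs in which large sets contain cliques -/

section Density

open scoped BoundedContinuousFunction

/-- The indicator function of a subset of a discrete space. -/
noncomputable def ind {Ω : Type*} [TopologicalSpace Ω] [DiscreteTopology Ω] (A : Set Ω) : Ω →ᵇ ℝ :=
  BoundedContinuousFunction.indicator A (isClopen_discrete A)

theorem ind_apply {Ω : Type*} [TopologicalSpace Ω] [DiscreteTopology Ω] (A : Set Ω) (ω : Ω)
    [Decidable (ω ∈ A)] : ind A ω = if ω ∈ A then 1 else 0 := by
  simp [ind, Set.indicator_apply]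

theorem ind_of_mem {Ω : Type*} [TopologicalSpace Ω] [DiscreteTopology Ω] {A : Set Ω} {ω : Ω}
    (h : ω ∈ A) : ind A ω = 1 := by
  classical
  rw [ind_apply, if_pos h]

theorem ind_nonneg {Ω : Type*} [TopologicalSpace Ω] [DiscreteTopology Ω] (A : Set Ω) (ω : Ω) :
    0 ≤ ind A ω := by
  classical
  rw [ind_apply]
  split_ifs <;> simp

theorem ind_add_ind_sdiff_le {Ω : Type*} [TopologicalSpace Ω] [DiscreteTopology Ω]
    {X Y Z : Set Ω} (hX : X ⊆ Z) (hY : Y ⊆ Z) (ω : Ω) :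
    (ind X + ind (Y \ X)) ω ≤ ind Z ω := by
  classical
  have hX' := @hX ω
  have hY' := @hY ω
  simp only [BoundedContinuousFunction.coe_add, Pi.add_apply, ind_apply, Set.mem_sdiff]
  by_cases h1 : ω ∈ X <;> by_cases h2 : ω ∈ Y <;> by_cases h3 : ω ∈ Z <;> simp_all

theorem ind_le_ind_sdiff_add {Ω : Type*} [TopologicalSpace Ω] [DiscreteTopology Ω]
    {A X : Set Ω} (hAX : Disjoint A X) (Y : Set Ω) (ω : Ω) :
    ind A ω ≤ (ind (A \ Y) + ind (Y \ X)) ω := by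
  classical
  have h : ω ∈ A → ω ∉ X := fun h => Set.disjoint_left.1 hAX h
  simp only [BoundedContinuousFunction.coe_add, Pi.add_apply, ind_apply, Set.mem_sdiff]
  by_cases h1 : ω ∈ X <;> by_cases h2 : ω ∈ Y <;> by_cases h3 : ω ∈ A <;> simp_all

open scoped Classical in
/-- If the total weight of the `A i` that occur is at most `δ` off `C`, then off `Y` it is
bounded by `δ` plus the indicator of `C`. -/
theorem sum_smul_ind_sdiff_le {Ω ι : Type*} [TopologicalSpace Ω] [DiscreteTopology Ω] [Fintype ι]
    {p : ι → ℝ} (hp : ∀ i, 0 ≤ p i) (hp1 : ∑ i, p i = 1) (A : ι → Set Ω) {C : Set Ω} {δ : ℝ}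
    (hδ : 0 ≤ δ) (h : ∀ ω ∉ C, ∀ T : Finset ι, (∀ i ∈ T, ω ∈ A i) → ∑ i ∈ T, p i ≤ δ)
    (Y : Set Ω) (ω : Ω) :
    (∑ i, p i • ind (A i \ Y)) ω ≤ (δ • (1 : Ω →ᵇ ℝ) + ind (C \ Y)) ω := by
  have e : (∑ i, p i • ind (A i \ Y)) ω = ∑ i, p i * ind (A i \ Y) ω := by simp
  have e' : (δ • (1 : Ω →ᵇ ℝ) + ind (C \ Y)) ω = δ + ind (C \ Y) ω := by simp
  rw [e, e']
  by_cases hY : ω ∈ Y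
  · have h0 : ∀ X : Set Ω, ind (X \ Y) ω = 0 := fun X => by simp [ind_apply, hY]
    simpa [h0] using hδ
  have h1 : ∀ X : Set Ω, ind (X \ Y) ω = if ω ∈ X then 1 else 0 := fun X => by
    simp [ind_apply, hY]
  simp only [h1, mul_ite, mul_one, mul_zero, ← Finset.sum_filter]
  by_cases hC : ω ∈ C
  · rw [if_pos hC]
    have : ∑ i with ω ∈ A i, p i ≤ 1 := by
      rw [← hp1]
      exact Finset.sum_le_univ_sum_of_nonneg hp
    linarith
  · rw [if_neg hC, add_zero]
    exact h ω hC _ fun i hi => (Finset.mem_filter.1 hi).2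

/-- A minimax principle: if every finite convex combination of the indicator functions of the sets
`A v` takes a value `≥ ε`, then there is a finitely additive probability measure on `Ω`, given here
as a positive functional on the bounded functions, for which every `A v` has measure `≥ ε`. -/
theorem exists_positive_functional {Ω V : Type*} [TopologicalSpace Ω] [DiscreteTopology Ω]
    [Nonempty V] (A : V → Set Ω) (ε : ℝ)
    (h : ∀ (ι : Type) [Fintype ι] (w : ι → ℝ) (v : ι → V), (∀ i, 0 ≤ w i) → ∑ i, w i = 1 →
      ∃ ω, ε ≤ ∑ i, w i * ind (A (v i)) ω) :
    ∃ Φ : (Ω →ᵇ ℝ) →ₗ[ℝ] ℝ, (∀ f g : Ω →ᵇ ℝ, (∀ ω, f ω ≤ g ω) → Φ f ≤ Φ g) ∧ Φ 1 = 1 ∧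
      ∀ v, ε ≤ Φ (ind (A v)) := by
  -- the interior of the set of functions with values `< ε`, to be separated from the convex hull
  let D : Set (Ω →ᵇ ℝ) := {f | ∃ δ > 0, ∀ ω, f ω ≤ ε - δ}
  have hDc : Convex ℝ D := by
    rintro f ⟨δ, hδ, hf⟩ g ⟨δ', hδ', hg⟩ a b ha hb hab
    refine ⟨min δ δ', lt_min hδ hδ', fun ω => ?_⟩
    have h1 : f ω ≤ ε - min δ δ' := (hf ω).trans (by linarith [min_le_left δ δ'])
    have h2 : g ω ≤ ε - min δ δ' := (hg ω).trans (by linarith [min_le_right δ δ'])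
    calc (a • f + b • g) ω = a * f ω + b * g ω := by simp
      _ ≤ a * (ε - min δ δ') + b * (ε - min δ δ') := by gcongr
      _ = ε - min δ δ' := by rw [← add_mul, hab, one_mul]
  have hDo : IsOpen D := by
    rw [Metric.isOpen_iff]
    rintro f ⟨δ, hδ, hf⟩
    refine ⟨δ / 2, by positivity, fun g hg => ⟨δ / 2, by positivity, fun ω => ?_⟩⟩
    have h1 : dist (g ω) (f ω) < δ / 2 :=
      (BoundedContinuousFunction.dist_coe_le_dist ω).trans_lt hg
    have h2 := (abs_lt.1 (Real.dist_eq _ _ ▸ h1)).2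
    linarith [hf ω]
  have hdisj : Disjoint D (convexHull ℝ (Set.range fun v => ind (A v))) := by
    rw [Set.disjoint_left]
    rintro f ⟨δ, hδ, hf⟩ hmem
    obtain ⟨ι, _, w, z, hw, hw1, hz, rfl⟩ := mem_convexHull_iff_exists_fintype.1 hmem
    choose v hv using hz
    obtain ⟨ω, hω⟩ := h ι w v hw hw1
    have h1 := hf ω
    have h2 : (∑ i, w i • z i) ω = ∑ i, w i * ind (A (v i)) ω := by
      simp [← hv]
    linarith
  obtain ⟨Ψ, u, hΨD, hΨ⟩ := geometric_hahn_banach_open hDc hDo (convex_convexHull ℝ _) hdisj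
  have hlow : ∀ c < ε, ∀ g : Ω →ᵇ ℝ, (∀ ω, 0 ≤ g ω) → c * Ψ 1 - Ψ g < u := by
    intro c hc g hg
    have := hΨD (c • (1 : Ω →ᵇ ℝ) - g) ⟨ε - c, by linarith, fun ω => by simp [hg ω]⟩
    simpa using this
  have hpos : ∀ g : Ω →ᵇ ℝ, (∀ ω, 0 ≤ g ω) → 0 ≤ Ψ g := by
    intro g hg
    by_contra! hneg
    -- a large multiple of `g` would violate the separation
    have key : ∀ t : ℝ, 0 ≤ t → (ε - 1) * Ψ 1 - t * Ψ g < u := by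
      intro t ht
      have := hlow (ε - 1) (by linarith) (t • g) fun ω => by simpa using mul_nonneg ht (hg ω)
      simpa using this
    have := key ((|u - (ε - 1) * Ψ 1| + 1) / -Ψ g)
      (div_nonneg (by positivity) (by linarith))
    have e : (|u - (ε - 1) * Ψ 1| + 1) / -Ψ g * Ψ g = -(|u - (ε - 1) * Ψ 1| + 1) := by
      rw [div_neg, neg_mul, div_mul_cancel₀ _ hneg.ne]
    rw [e] at this
    linarith [le_abs_self (u - (ε - 1) * Ψ 1)]
  have hmono : ∀ f g : Ω →ᵇ ℝ, (∀ ω, f ω ≤ g ω) → Ψ f ≤ Ψ g := by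
    intro f g hfg
    have := hpos (g - f) fun ω => by simpa using hfg ω
    rw [map_sub] at this
    linarith
  have hu : ε * Ψ 1 ≤ u := by
    have h1 : 0 ≤ Ψ 1 := hpos 1 fun ω => by simp
    refine le_of_forall_pos_le_add fun δ hδ => ?_
    have := hlow (ε - δ / (Ψ 1 + 1)) (by linarith [show 0 < δ / (Ψ 1 + 1) by positivity]) 0
      fun ω => by simp
    have h2 : δ / (Ψ 1 + 1) * Ψ 1 ≤ δ := by
      rw [div_mul_eq_mul_div, div_le_iff₀ (by linarith)]
      nlinarith
    rw [map_zero, sub_mul] at this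
    linarith
  have h1pos : 0 < Ψ 1 := by
    refine lt_of_le_of_ne (hpos 1 fun ω => by simp) fun h0 => ?_
    -- otherwise the functional vanishes, which contradicts the strict separation
    have hz : ∀ f : Ω →ᵇ ℝ, Ψ f ≤ 0 := by
      intro f
      have := hmono f (‖f‖ • 1) fun ω => by
        simpa using (le_abs_self _).trans (f.norm_coe_le_norm ω)
      rw [map_smul, ← h0, smul_zero] at this
      exact this
    have h2 := hlow (ε - 1) (by linarith) 0 fun ω => by simp
    obtain ⟨v⟩ := ‹Nonempty V›
    have h3 := hΨ _ (subset_convexHull ℝ _ ⟨v, rfl⟩)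
    rw [← h0, map_zero] at h2
    linarith [hz (ind (A v))]
  refine ⟨(Ψ 1)⁻¹ • (Ψ : (Ω →ᵇ ℝ) →ₗ[ℝ] ℝ), fun f g hfg => ?_, ?_, fun v => ?_⟩
  · simpa using mul_le_mul_of_nonneg_left (hmono f g hfg) (inv_nonneg.2 h1pos.le)
  · simpa using inv_mul_cancel₀ h1pos.ne'
  · have h3 := hu.trans (hΨ _ (subset_convexHull ℝ _ ⟨v, rfl⟩))
    have : ε ≤ (Ψ 1)⁻¹ * Ψ (ind (A v)) := by
      rw [inv_mul_eq_div, le_div_iff₀ h1pos]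
      exact h3
    simpa using this

/-- For every `ε > 0` there is a finite `K_{k+1}`-free graph with a probability measure on its
vertices for which every set of vertices without `k`-cliques has measure `< ε`. -/
def HasSparseWeights (k : ℕ) : Prop :=
  ∀ ε : ℝ, 0 < ε → ∃ (ι : Type) (_ : Fintype ι) (H : SimpleGraph ι) (w : ι → ℝ),
    H.CliqueFree (k + 1) ∧ (∀ i, 0 ≤ w i) ∧ ∑ i, w i = 1 ∧
    ∀ S : Finset ι, H.CliqueFreeOn S k → ∑ i ∈ S, w i < ε

theorem hasSparseWeights_one : HasSparseWeights 1 := by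
  intro ε hε
  refine ⟨Unit, inferInstance, ⊥, fun _ => 1, ?_, by simp, by simp, fun S hS => ?_⟩
  · rw [cliqueFree_iff_forall_fun]
    intro f hf
    exact hf 0 1 (by decide)
  · have : S = ∅ := by
      rw [Finset.eq_empty_iff_forall_notMem]
      intro x hx
      rw [cliqueFreeOn_iff_forall_fun] at hS
      exact hS (fun _ => x) (fun _ => hx) fun i j hij => (hij (Subsingleton.elim i j)).elim
    simpa [this] using hε

open scoped Classical in
/-- The induction step. If the claim failed for some `ε`, then by minimax there would be a finitely
additive random finite set `S` of vertices of `G`, without `(k+1)`-cliques, that contains each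
vertex with probability `≥ ε`. Let `B I` be the event that `S` contains a `k`-clique of `I`. By
induction on `n`, there are sets `I` without `(k+1)`-cliques, apart from any given finite set, such
that `B I` has probability `≥ n ε / 4`, which is absurd for large `n`. For the step, let `I'` and
`I i` be such sets for `n`, and let `w i` be adjacent to all of `I i`, such that the `w i` form a
copy of a graph `H` with sparse weights for `k`. Unless some `I i ∪ I'` is as required, `B (I i)`
almost covers `B I'`. Since `w i ∈ S` excludes `B (I i)`, it is almost disjoint from `B I'`. Hence
the part of the copy of `H` in `S` has average weight `≥ 3 ε / 4` outside `B I'`, so that it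
contains a `k`-clique with probability `≥ ε / 2` there, and the union of `I'` with this copy is as
required. -/
theorem HasSparseWeights.succ {V : Type*} {G : SimpleGraph V} {k : ℕ}
    (hG : IsGenericCliqueFree G (k + 1)) (hk : HasSparseWeights k) : HasSparseWeights (k + 1) := by
  intro ε hε
  by_contra hno
  let Ω := {S : Finset V // G.CliqueFreeOn S (k + 1)}
  let _ : TopologicalSpace Ω := ⊥
  have : DiscreteTopology Ω := ⟨rfl⟩
  have : Nonempty V := by
    obtain ⟨z, -⟩ := hG.exists_adj ∅ ∅ (by simp) (by simp)
    exact ⟨z⟩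
  obtain ⟨Φ, hΦ, hΦ1, hΦA⟩ := exists_positive_functional (fun v : V => {S : Ω | v ∈ S.1}) ε (by
    intro ι _ w v hw hw1
    by_contra! hlt
    -- weights on a family of vertices of `G`, possibly repeated, are weights on a pulled back graph
    refine hno ⟨ι, inferInstance, G.comap v, w, cliqueFree_comap hG.cliqueFree v, hw, hw1, ?_⟩
    intro S hS
    have hSv : G.CliqueFreeOn (↑(S.image v)) (k + 1) := by
      rw [Finset.coe_image]
      exact cliqueFreeOn_image hS v fun x _ y _ h => h
    refine lt_of_le_of_lt ?_ (hlt ⟨S.image v, hSv⟩)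
    rw [← Finset.sum_filter_add_sum_filter_not Finset.univ (· ∈ S)]
    rw [Finset.filter_univ_mem]
    refine le_add_of_le_of_nonneg (Finset.sum_le_sum fun i hi => ?_)
      (Finset.sum_nonneg fun i _ => mul_nonneg (hw i) (ind_nonneg _ _))
    rw [ind_of_mem (show _ ∈ {S : Ω | v i ∈ S.1} from Finset.mem_image_of_mem v hi), mul_one])
  let B : Finset V → Set Ω := fun I => {S | ¬ G.CliqueFreeOn (↑I ∩ ↑S.1) k}
  have hB : ∀ I J : Finset V, I ⊆ J → B I ⊆ B J := by
    intro I J hIJ S hS hSJ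
    exact hS (hSJ.subset _ (Set.inter_subset_inter_left _ (Finset.coe_subset.2 hIJ)))
  have key : ∀ n : ℕ, ∀ F : Finset V, ∃ I : Finset V, n * (ε / 4) ≤ Φ (ind (B I)) ∧
      G.CliqueFreeOn I (k + 1) ∧ ∀ a ∈ I, ∀ b ∈ F, a ≠ b ∧ ¬ G.Adj a b := by
    intro n
    induction n with
    | zero =>
      refine fun F => ⟨∅, ?_, by simp, by simp⟩
      rw [Nat.cast_zero, zero_mul, ← map_zero Φ]
      exact hΦ _ _ fun ω => ind_nonneg _ ω
    | succ n ih =>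
      intro F
      obtain ⟨ι, _, H, p, hH, hp, hp1, hpS⟩ := hk (ε / 4) (by positivity)
      obtain ⟨w, I, hw, hadj, hwI⟩ := hG.exists_embedding
        (fun I => n * (ε / 4) ≤ Φ (ind (B I))) ih H (hH.mono (Nat.le_succ _)) F
      set W : Finset V := Finset.univ.image w with hW
      obtain ⟨I', hI', hI'c, hI'F⟩ := ih (F ∪ W ∪ Finset.univ.biUnion I)
      by_cases hex : ∃ i, ((n + 1 : ℕ) : ℝ) * (ε / 4) ≤ Φ (ind (B (I i ∪ I')))
      · obtain ⟨i, hi⟩ := hex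
        obtain ⟨-, hIc, -, hIF, -⟩ := hwI i
        refine ⟨I i ∪ I', hi, ?_, ?_⟩
        · rw [Finset.coe_union]
          refine cliqueFreeOn_union hIc hI'c fun a ha b hb h => ?_
          refine (hI'F b hb a ?_).2 h.symm
          exact Finset.mem_union_right _ (Finset.mem_biUnion.2 ⟨i, Finset.mem_univ i, ha⟩)
        · intro a ha b hb
          rcases Finset.mem_union.1 ha with ha | ha
          · exact hIF a ha b hb
          · exact hI'F a ha b (Finset.mem_union_left _ (Finset.mem_union_left _ hb))
      push Not at hex
      have hA : ∀ i, ε - ε / 4 ≤ Φ (ind ({S : Ω | w i ∈ S.1} \ B I')) := by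
        intro i
        obtain ⟨hIn, -, hwadj, -, -⟩ := hwI i
        -- a `k`-clique of `I i` in `S` extends by `w i`
        have hdis : Disjoint {S : Ω | w i ∈ S.1} (B (I i)) := by
          refine Set.disjoint_left.2 fun S hS hSB => hSB ?_
          refine (SimpleGraph.CliqueFreeOn.of_succ G S.2 hS).subset G ?_
          exact fun a ha => ⟨ha.2, hwadj a ha.1⟩
        have h1 := hΦ _ _ (ind_le_ind_sdiff_add hdis (B I'))
        have h2 := hΦ _ _ (ind_add_ind_sdiff_le (hB (I i) (I i ∪ I') Finset.subset_union_left)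
          (hB I' (I i ∪ I') Finset.subset_union_right))
        have h3 := hex i
        have h4 := hΦA (w i)
        rw [map_add] at h1 h2
        push_cast at h3
        linarith
      have hsum := hΦ _ _ (sum_smul_ind_sdiff_le hp hp1 (fun i => {S : Ω | w i ∈ S.1}) (C := B W)
        (δ := ε / 4) (by positivity) (fun S hS T hT => by
          refine (hpS T ?_).le
          have hWS := not_not.1 hS
          rw [cliqueFreeOn_iff_forall_fun] at hWS ⊢
          intro f hf hfadj
          refine hWS (w ∘ f) (fun j => ⟨?_, ?_⟩) fun a b hab => (hadj _ _).2 (hfadj a b hab)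
          · exact Finset.mem_coe.2 (Finset.mem_image_of_mem w (Finset.mem_univ _))
          · exact hT _ (hf j)) (B I'))
      have hsum2 : ε - ε / 4 ≤ Φ (∑ i, p i • ind ({S : Ω | w i ∈ S.1} \ B I')) := by
        rw [map_sum]
        calc ε - ε / 4 = ∑ i, p i * (ε - ε / 4) := by rw [← Finset.sum_mul, hp1, one_mul]
          _ ≤ _ := Finset.sum_le_sum fun i _ => by
            rw [map_smul, smul_eq_mul]
            exact mul_le_mul_of_nonneg_left (hA i) (hp i)
      have hfin := hΦ _ _ (ind_add_ind_sdiff_le (hB I' (W ∪ I') Finset.subset_union_right)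
        (hB W (W ∪ I') Finset.subset_union_left))
      refine ⟨W ∪ I', ?_, ?_, ?_⟩
      · -- `n ε / 4 + ε / 2 ≥ (n + 1) ε / 4`
        rw [map_add] at hsum hfin
        rw [map_smul, hΦ1, smul_eq_mul] at hsum
        push_cast
        linarith
      · rw [Finset.coe_union]
        refine cliqueFreeOn_union ?_ hI'c fun a ha b hb h => ?_
        · rw [hW, Finset.coe_image]
          exact cliqueFreeOn_image hH.cliqueFreeOn w fun x _ y _ h => (hadj x y).1 h
        · exact (hI'F b hb a (Finset.mem_union_left _ (Finset.mem_union_right _ ha))).2 h.symm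
      · intro a ha b hb
        rcases Finset.mem_union.1 ha with ha | ha
        · obtain ⟨i, -, rfl⟩ := Finset.mem_image.1 ha
          exact (hwI i).2.2.2.2 b hb
        · exact hI'F a ha b (Finset.mem_union_left _ (Finset.mem_union_left _ hb))
  obtain ⟨n, hn⟩ := exists_nat_gt (1 / (ε / 4))
  obtain ⟨I, hI, -⟩ := key n ∅
  have h1 : Φ (ind (B I)) ≤ Φ 1 := hΦ _ _ fun S => by
    rw [ind_apply]
    split_ifs <;> simp
  rw [div_lt_iff₀ (by positivity)] at hn
  linarith

theorem IsGenericCliqueFree.hasSparseWeights {V : Type*} {G : SimpleGraph V} {k : ℕ}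
    (hk : 1 ≤ k) (hG : IsGenericCliqueFree G k) : HasSparseWeights k := by
  induction k, hk using Nat.le_induction generalizing V with
  | base => exact hasSparseWeights_one
  | succ k hk ih =>
    obtain ⟨c, -⟩ := hG.exists_adj ∅ ∅ (by simp) (by simp)
    exact (ih (hG.induce_neighborSet c)).succ hG

open scoped Classical in
/-- A generic `K_{k+1}`-free graph contains arbitrarily large finite sets of vertices in which every
set without `k`-cliques has density at most `ε`. -/
theorem IsGenericCliqueFree.exists_sparse {V : Type*} {G : SimpleGraph V} {k : ℕ}
    (hk : 1 ≤ k) (hG : IsGenericCliqueFree G k) {ε : ℝ} (hε : 0 < ε) :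
    ∃ (m : ℕ) (a : Fin (m + 1) → V), Function.Injective a ∧ 1 ≤ ε * (m + 1 : ℕ) ∧
      ∀ S : Set V, G.CliqueFreeOn S k →
        ((Finset.univ.filter fun i => a i ∈ S).card : ℝ) ≤ ε * (m + 1 : ℕ) := by
  obtain ⟨ι, _, H, p, hH, hp, hp1, hpS⟩ := hG.hasSparseWeights hk (ε / 2) (by positivity)
  obtain ⟨N, hN⟩ := exists_nat_gt (max 1 (max (1 / ε) (Fintype.card ι / (ε / 2))))
  rw [max_lt_iff, max_lt_iff, div_lt_iff₀ hε, div_lt_iff₀ (by positivity)] at hN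
  obtain ⟨hN1, hN2, hN3⟩ := hN
  -- the blow-up of `H` in which each vertex is replaced by a number of copies roughly
  -- proportional to its weight
  let κ := Σ i, Fin ⌈N * p i⌉₊
  have hcard : (N : ℝ) ≤ Fintype.card κ := by
    rw [Fintype.card_sigma]
    push_cast
    calc (N : ℝ) = ∑ i, N * p i := by rw [← Finset.mul_sum, hp1, mul_one]
      _ ≤ _ := Finset.sum_le_sum fun i _ => by simpa using Nat.le_ceil _
  obtain ⟨m, hm⟩ : ∃ m, Fintype.card κ = m + 1 :=
    Nat.exists_eq_succ_of_ne_zero fun h => by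
      rw [h, Nat.cast_zero] at hcard
      linarith
  let e : Fin (m + 1) ≃ κ := (finCongr hm.symm).trans (Fintype.equivFin κ).symm
  obtain ⟨w, -, hw, hadj, -⟩ := hG.exists_embedding (fun I => I = ∅)
    (fun F => ⟨∅, rfl, by simpa using by omega, by simp⟩)
    (H.comap (Sigma.fst : κ → ι)) (cliqueFree_comap hH _) ∅
  refine ⟨m, w ∘ e, hw.comp e.injective, ?_, fun S hS => ?_⟩
  · rw [← hm]
    nlinarith
  · have h1 : (Finset.univ.filter fun i => (w ∘ e) i ∈ S).card =
        (Finset.univ.filter fun x => w x ∈ S).card := by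
      refine Finset.card_bij (fun i _ => e i) ?_ ?_ ?_
      · intro i hi
        simpa using hi
      · exact fun i _ j _ h => e.injective h
      · intro x hx
        exact ⟨e.symm x, by simpa using hx, by simp⟩
    set T : Finset ι := (Finset.univ.filter fun x => w x ∈ S).image Sigma.fst with hT
    have hTc : H.CliqueFreeOn T k := by
      rw [cliqueFreeOn_iff_forall_fun] at hS ⊢
      intro f hf hfadj
      have : ∀ j, ∃ x : κ, w x ∈ S ∧ x.1 = f j := by
        intro j
        obtain ⟨x, hx, hxj⟩ := Finset.mem_image.1 (Finset.mem_coe.1 (hf j))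
        exact ⟨x, (Finset.mem_filter.1 hx).2, hxj⟩
      choose x hxS hxf using this
      refine hS (w ∘ x) hxS fun i j hij => (hadj _ _).2 ?_
      rw [SimpleGraph.comap_adj, hxf, hxf]
      exact hfadj i j hij
    have h2 : (Finset.univ.filter fun x => w x ∈ S) ⊆ T.sigma fun _ => Finset.univ := by
      intro x hx
      exact Finset.mem_sigma.2 ⟨Finset.mem_image_of_mem _ hx, Finset.mem_univ _⟩
    have h3 := Finset.card_le_card h2
    rw [Finset.card_sigma] at h3
    have h4 : (∑ i ∈ T, ((Finset.univ : Finset (Fin ⌈N * p i⌉₊)).card : ℝ)) ≤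
        ∑ i ∈ T, (N * p i + 1) := by
      refine Finset.sum_le_sum fun i _ => ?_
      rw [Finset.card_univ, Fintype.card_fin]
      exact (Nat.ceil_lt_add_one (mul_nonneg N.cast_nonneg (hp i))).le
    rw [Finset.sum_add_distrib, ← Finset.mul_sum, Finset.sum_const, nsmul_eq_mul, mul_one] at h4
    have h5 : (T.card : ℝ) ≤ Fintype.card ι := by exact_mod_cast Finset.card_le_univ T
    have h6 := hpS T hTc
    rw [h1, ← hm]
    calc ((Finset.univ.filter fun x => w x ∈ S).card : ℝ)
        ≤ ∑ i ∈ T, ((Finset.univ : Finset (Fin ⌈N * p i⌉₊)).card : ℝ) := by exact_mod_cast h3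
      _ ≤ ε * N := by nlinarith
      _ ≤ ε * Fintype.card κ := by gcongr

end Density

/-! ### Elimination of quantifiers -/

section ModelTheory

theorem realize_adjFormula {V : Type*} {β : Type} [Language.graph.Structure V] (i j : β)
    (v : β → V) :
    (adjFormula i j).Realize v ↔ Structure.RelMap adj ![v i, v j] := by
  simp [adjFormula, Formula.realize_rel₂]

theorem realize_eqFormula {V : Type*} {β : Type} [Language.graph.Structure V] (i j : β)
    (v : β → V) :
    (eqFormula i j).Realize v ↔ v i = v j := by
  simp [eqFormula, Formula.realize_equal]

theorem realize_cliqueFormula {V : Type*} {β : Type} [Language.graph.Structure V] {r : ℕ}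
    (σ : Fin r → β) (v : β → V) : (cliqueFormula σ).Realize v ↔
      ∀ i j, i ≠ j → Structure.RelMap adj ![v (σ i), v (σ j)] := by
  simp only [cliqueFormula, Formula.realize_iInf, realize_adjFormula]
  exact ⟨fun h i j hij => h ⟨(i, j), hij⟩, fun h ij => h _ _ ij.2⟩

open scoped Classical in
/-- A model of the theory of the random `K_{k+1}`-free graph is a generic `K_{k+1}`-free graph. -/
theorem exists_isGenericCliqueFree {V : Type*} [Language.graph.Structure V] {k : ℕ}
    (hV : V ⊨ randomCliqueFreeGraph (k + 1)) :
    ∃ G : SimpleGraph V, (∀ x y, G.Adj x y ↔ Structure.RelMap adj ![x, y]) ∧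
      IsGenericCliqueFree G k := by
  have hsg : V ⊨ Theory.simpleGraph := hV.mono fun φ hφ => Or.inl (Or.inl hφ)
  have hcf : V ⊨ cliqueFreeSentence (k + 1) := hV.realize_of_mem _ (Or.inl (Or.inr rfl))
  refine ⟨simpleGraphOfStructure V, fun x y => Iff.rfl, ?_, fun A B hAB hA => ?_⟩
  · rw [cliqueFree_iff_forall_fun]
    intro f hf
    simp only [Sentence.Realize, cliqueFreeSentence, Formula.realize_iAlls, Formula.realize_not,
      realize_cliqueFormula] at hcf
    exact hcf f hf
  · have hext : V ⊨ extensionSentence (k + 1) A.card B.card :=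
      hV.realize_of_mem _ (Or.inr ⟨(A.card, B.card), rfl⟩)
    simp only [Sentence.Realize, extensionSentence, Formula.realize_iAlls, Formula.realize_relabel,
      Formula.realize_imp, Formula.realize_iExs, admissibleFormula, extendsFormula,
      Formula.realize_inf, Formula.realize_iInf, Formula.realize_not, realize_cliqueFormula,
      realize_adjFormula, realize_eqFormula, Function.comp_apply, Sum.elim_inl,
      Sum.elim_inr] at hext
    obtain ⟨z, hzA, hzB⟩ := hext (Sum.elim (fun i => (A.equivFin.symm i : V))
        fun i => (B.equivFin.symm i : V)) ⟨fun σ hσ => by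
      rw [cliqueFreeOn_iff_forall_fun] at hA
      exact hA (fun i => A.equivFin.symm (σ i)) (fun i => (A.equivFin.symm (σ i)).2) hσ,
      fun ij h => Finset.disjoint_left.1 hAB (A.equivFin.symm ij.1).2
        ((show (A.equivFin.symm ij.1 : V) = B.equivFin.symm ij.2 from h) ▸
          (B.equivFin.symm ij.2).2)⟩
    refine ⟨z 0, fun hz => ?_, fun a ha => ?_, fun b hb => ?_⟩
    · simpa using (hzB (B.equivFin ⟨z 0, hz⟩)).2
    · simpa using hzA (A.equivFin ⟨a, ha⟩)
    · simpa using (hzB (B.equivFin ⟨b, hb⟩)).1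

/-- Two tuples in a graph satisfy the same atomic formulas. -/
def SameAtomic {V β : Type*} (G : SimpleGraph V) (p p' : β → V) : Prop :=
  ∀ i j, (p i = p j ↔ p' i = p' j) ∧ (G.Adj (p i) (p j) ↔ G.Adj (p' i) (p' j))

theorem SameAtomic.symm {V β : Type*} {G : SimpleGraph V} {p p' : β → V} (h : SameAtomic G p p') :
    SameAtomic G p' p :=
  fun i j => ⟨(h i j).1.symm, (h i j).2.symm⟩

open scoped Classical in
/-- The extension step of the back-and-forth argument. -/
theorem IsGenericCliqueFree.exists_extension {V β : Type*} [Finite β] {G : SimpleGraph V} {k : ℕ}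
    (hG : IsGenericCliqueFree G k) {p p' : β → V} (h : SameAtomic G p p') (a : V) :
    ∃ a', ∀ i, (a = p i ↔ a' = p' i) ∧ (G.Adj a (p i) ↔ G.Adj a' (p' i)) := by
  by_cases ha : ∃ j, a = p j
  · obtain ⟨j, rfl⟩ := ha
    exact ⟨p' j, h j⟩
  push Not at ha
  have := Fintype.ofFinite β
  obtain ⟨z, hzB, hzA, hzB'⟩ := hG.exists_adj
    ((Finset.univ.filter fun i => G.Adj a (p i)).image p')
    ((Finset.univ.filter fun i => ¬ G.Adj a (p i)).image p') (by
      rw [Finset.disjoint_left]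
      intro x hx hx'
      obtain ⟨i, hi, rfl⟩ := Finset.mem_image.1 hx
      obtain ⟨j, hj, hij⟩ := Finset.mem_image.1 hx'
      have := (h j i).1.2 hij
      simp only [Finset.mem_filter, Finset.mem_univ, true_and] at hi hj
      exact hj (this ▸ hi)) (by
      have h1 : (G.comap p).CliqueFreeOn {i | G.Adj a (p i)} k := by
        have := cliqueFreeOn_of_forall_adj (S := G.neighborSet a) hG.cliqueFree fun a ha => ha
        rw [cliqueFreeOn_iff_forall_fun] at this ⊢
        exact fun f hf => this (p ∘ f) hf
      have := cliqueFreeOn_image (G := G) h1 p' fun x _ y _ hxy => (h x y).2.2 hxy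
      rw [Finset.coe_image]
      simpa using this)
  have hz : ∀ i, z ≠ p' i ∧ (G.Adj a (p i) ↔ G.Adj z (p' i)) := by
    intro i
    by_cases hi : G.Adj a (p i)
    · have := hzA (p' i) (Finset.mem_image_of_mem _ (by simpa using hi))
      exact ⟨this.ne, iff_of_true hi this⟩
    · have hm : p' i ∈ (Finset.univ.filter fun i => ¬ G.Adj a (p i)).image p' :=
        Finset.mem_image_of_mem _ (by simpa using hi)
      exact ⟨fun h => hzB (h ▸ hm), iff_of_false hi (hzB' _ hm)⟩
  exact ⟨z, fun i => ⟨iff_of_false (ha i) (hz i).1, (hz i).2⟩⟩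

theorem SameAtomic.snoc {V α : Type*} {G : SimpleGraph V} {m : ℕ} {v v' : α → V}
    {xs xs' : Fin m → V} (h : SameAtomic G (Sum.elim v xs) (Sum.elim v' xs')) {a a' : V}
    (ha : ∀ i, (a = Sum.elim v xs i ↔ a' = Sum.elim v' xs' i) ∧
      (G.Adj a (Sum.elim v xs i) ↔ G.Adj a' (Sum.elim v' xs' i))) :
    SameAtomic G (Sum.elim v (Fin.snoc xs a : Fin (m + 1) → V))
      (Sum.elim v' (Fin.snoc xs' a' : Fin (m + 1) → V)) := by
  have key : ∀ x : α ⊕ Fin (m + 1),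
      (Sum.elim v (Fin.snoc xs a : Fin (m + 1) → V) x = a ∧
        Sum.elim v' (Fin.snoc xs' a' : Fin (m + 1) → V) x = a') ∨
      ∃ y, Sum.elim v (Fin.snoc xs a : Fin (m + 1) → V) x = Sum.elim v xs y ∧
        Sum.elim v' (Fin.snoc xs' a' : Fin (m + 1) → V) x = Sum.elim v' xs' y := by
    rintro (x | x)
    · exact Or.inr ⟨Sum.inl x, rfl, rfl⟩
    · induction x using Fin.lastCases with
      | last => exact Or.inl (by simp)
      | cast x => exact Or.inr ⟨Sum.inr x, by simp⟩
  intro x y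
  rcases key x with ⟨h1, h2⟩ | ⟨x', h1, h2⟩ <;> rcases key y with ⟨h3, h4⟩ | ⟨y', h3, h4⟩ <;>
    rw [h1, h2, h3, h4]
  · simp
  · exact ha y'
  · rw [eq_comm, eq_comm (a := Sum.elim v' xs' x'), G.adj_comm, G.adj_comm _ a']
    exact ha x'
  · exact h x' y'

/-- Quantifier elimination: in a generic `K_{k+1}`-free graph, tuples that satisfy the same atomic
formulas satisfy the same formulas. -/
theorem IsGenericCliqueFree.realize_iff {V α : Type*} [Finite α] [Language.graph.Structure V]
    {G : SimpleGraph V} {k : ℕ} (hadj : ∀ x y, G.Adj x y ↔ Structure.RelMap adj ![x, y])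
    (hG : IsGenericCliqueFree G k) {m : ℕ} (φ : Language.graph.BoundedFormula α m)
    {v v' : α → V} {xs xs' : Fin m → V}
    (h : SameAtomic G (Sum.elim v xs) (Sum.elim v' xs')) :
    φ.Realize v xs ↔ φ.Realize v' xs' := by
  have hterm : ∀ {m : ℕ} (t : Language.graph.Term (α ⊕ Fin m)), ∃ i, t = Term.var i := by
    intro m t
    cases t with
    | var i => exact ⟨i, rfl⟩
    | func f _ => exact isEmptyElim f
  induction φ with
  | falsum => exact Iff.rfl
  | equal t₁ t₂ =>
    obtain ⟨i, rfl⟩ := hterm t₁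
    obtain ⟨j, rfl⟩ := hterm t₂
    exact (h i j).1
  | rel R ts =>
    cases R
    obtain ⟨i, hi⟩ := hterm (ts 0)
    obtain ⟨j, hj⟩ := hterm (ts 1)
    have e : ∀ (v : α → V) xs, (fun l => (ts l).realize (Sum.elim v xs)) =
        ![Sum.elim v xs i, Sum.elim v xs j] := by
      intro v xs
      funext l
      fin_cases l
      · simp [hi]
      · simp [hj]
    simp only [BoundedFormula.Realize]
    rw [e, e, ← hadj, ← hadj]
    exact (h i j).2
  | imp φ ψ ih₁ ih₂ => exact imp_congr (ih₁ h) (ih₂ h)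
  | all φ ih =>
    constructor
    · intro hφ a'
      obtain ⟨a, ha⟩ := hG.exists_extension h.symm a'
      exact (ih (h.snoc fun i => ⟨(ha i).1.symm, (ha i).2.symm⟩)).1 (hφ a)
    · intro hφ a
      obtain ⟨a', ha⟩ := hG.exists_extension h a
      exact (ih (h.snoc ha)).2 (hφ a')

/-- A vertex neither in the tuple `b` nor adjacent to it satisfies the same formulas over `b` as any
other such vertex. -/
theorem IsGenericCliqueFree.realize_iff_of_apart {V : Type*} [Language.graph.Structure V]
    {G : SimpleGraph V} {k : ℕ} (hadj : ∀ x y, G.Adj x y ↔ Structure.RelMap adj ![x, y])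
    (hG : IsGenericCliqueFree G k) {l : ℕ} (φ : Language.graph.Formula (Fin 1 ⊕ Fin l))
    {b : Fin l → V} {a a' : Fin 1 → V} (ha : ∀ j, a 0 ≠ b j ∧ ¬ G.Adj (a 0) (b j))
    (ha' : ∀ j, a' 0 ≠ b j ∧ ¬ G.Adj (a' 0) (b j)) :
    φ.Realize (Sum.elim a b) ↔ φ.Realize (Sum.elim a' b) := by
  refine hG.realize_iff hadj φ ?_
  rintro ((i | i) | i) ((j | j) | j)
  · rw [Subsingleton.elim i j]
    simp
  · rw [Subsingleton.elim i 0]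
    exact ⟨iff_of_false (ha j).1 (ha' j).1, iff_of_false (ha j).2 (ha' j).2⟩
  · exact j.elim0
  · rw [Subsingleton.elim j 0]
    refine ⟨iff_of_false (ha i).1.symm (ha' i).1.symm, ?_⟩
    exact iff_of_false (fun h => (ha i).2 h.symm) fun h => (ha' i).2 h.symm
  · exact ⟨Iff.rfl, Iff.rfl⟩
  · exact j.elim0
  all_goals exact i.elim0

open scoped Classical in
/-- Every formula with parameters is equivalent to an instance of a formula without parameters. -/
theorem exists_instParams {L : FirstOrder.Language} {U : Type*} [L.Structure U] {n : ℕ}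
    (ψ : L[[U]].Formula (Fin n)) : ∃ (l : ℕ) (φ : L.Formula (Fin n ⊕ Fin l)) (b : Fin l → U),
      ∀ a : Fin n → U, ψ.Realize a ↔ (instParams φ b).Realize a := by
  let χ : L.BoundedFormula (U ⊕ Fin n) 0 := BoundedFormula.constantsVarsEquiv ψ
  let P : Finset U := χ.freeVarFinset.toLeft
  refine ⟨P.card, χ.restrictFreeVar fun x => Sum.casesOn (motive := fun y =>
      y ∈ χ.freeVarFinset → Fin n ⊕ Fin P.card) x.1
    (fun u hu => Sum.inr (P.equivFin ⟨u, Finset.mem_toLeft.2 hu⟩)) (fun i _ => Sum.inl i) x.2,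
    fun j => P.equivFin.symm j, fun a => ?_⟩
  rw [realize_instParams]
  have h1 : χ.Realize (Sum.elim (fun u => u) a) default ↔ ψ.Realize a := by
    have := BoundedFormula.realize_constantsVarsEquiv (L := L) (M := U) (φ := ψ) (v := a)
      (xs := default)
    exact this
  rw [← h1]
  refine (BoundedFormula.realize_restrictFreeVar _ ?_).symm
  rintro ⟨u | i, hu⟩
  · simp
  · simp

/-! ### Global types -/

section Types

variable {L : FirstOrder.Language} {U : Type*} [L.Structure U]

theorem GlobalType.Contains.mono {n : ℕ} {p : GlobalType L U n} {φ ψ : L[[U]].Formula (Fin n)}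
    (hp : p.Contains φ) (h : ∀ a : Fin n → U, φ.Realize a → ψ.Realize a) : p.Contains ψ := by
  obtain ⟨N, v, hN⟩ := p.exists_realize
  have := realize_of_forall N v (φ.imp ψ) (by simpa only [Formula.realize_imp] using h)
  rw [Formula.realize_imp] at this
  exact (hN _).2 (this ((hN _).1 hp))

theorem GlobalType.contains_not_iff {n : ℕ} (p : GlobalType L U n) (φ : L[[U]].Formula (Fin n)) :
    p.Contains φ.not ↔ ¬ p.Contains φ := by
  obtain ⟨N, v, hN⟩ := p.exists_realize
  rw [hN, hN, Formula.realize_not]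

theorem GlobalType.ext_contains {n : ℕ} {p q : GlobalType L U n}
    (h : ∀ φ, p.Contains φ ↔ q.Contains φ) : p = q := by
  refine SetLike.ext fun σ => ?_
  have := h (Formula.equivSentence.symm σ)
  simpa [GlobalType.Contains] using this

theorem isOpen_contains {n : ℕ} (φ : L[[U]].Formula (Fin n)) :
    IsOpen {p : GlobalType L U n | p.Contains φ} :=
  CompleteType.isOpen_typesWith _

variable [Nonempty U]

theorem tp_contains {n : ℕ} (a : Fin n → U) (φ : L[[U]].Formula (Fin n)) :
    (tp (L := L) a).Contains φ ↔ φ.Realize a :=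
  Theory.CompleteType.formula_mem_typeOf

theorem eventually_realize_iff {n : ℕ} {p : GlobalType L U n} {ι : Type*} {F : Filter ι}
    {a : ι → Fin n → U} (h : Tendsto (fun i => tp (L := L) (a i)) F (𝓝 p))
    (φ : L[[U]].Formula (Fin n)) : ∀ᶠ i in F, (φ.Realize (a i) ↔ p.Contains φ) := by
  by_cases hp : p.Contains φ
  · filter_upwards [h.eventually ((isOpen_contains φ).mem_nhds hp)] with i hi
    exact iff_of_true ((tp_contains _ _).1 hi) hp
  · filter_upwards [h.eventually ((isOpen_contains φ.not).mem_nhds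
      ((p.contains_not_iff φ).2 hp))] with i hi
    have := (tp_contains _ _).1 hi
    rw [Formula.realize_not] at this
    exact iff_of_false this hp

/-- A limit of types of tuples that are eventually constant is realized. -/
theorem GlobalType.isRealized_of_eventually_eq {n : ℕ} {p : GlobalType L U n} {a : ℕ → Fin n → U}
    (h : Tendsto (fun i => tp (L := L) (a i)) atTop (𝓝 p))
    (hc : ∀ j, ∃ c, ∀ᶠ i in atTop, a i j = c) : p.IsRealized := by
  choose c hc using hc
  refine ⟨c, tendsto_nhds_unique h (tendsto_const_nhds.congr' ?_)⟩
  filter_upwards [eventually_all.2 hc] with i hi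
  rw [show a i = c from funext hi]

end Types

end ModelTheory

/-! ### The type of a vertex adjacent to nothing -/

section NonAdjacentType

variable {U : Type*} [Language.graph.Structure U] {G : SimpleGraph U} {k : ℕ}

theorem realize_notAdj (hadj : ∀ x y, G.Adj x y ↔ Structure.RelMap adj ![x, y]) (b : U)
    (a : Fin 1 → U) : (notAdj b).Realize a ↔ ¬ G.Adj (a 0) b := by
  rw [notAdj, realize_instParams, Formula.realize_not, realize_adjFormula, hadj]
  rfl

/-- A type containing all `¬ E(x, b)` contains the formulas with parameters `b` that hold of the
vertices apart from `b`. -/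
theorem contains_of_forall_apart (hadj : ∀ x y, G.Adj x y ↔ Structure.RelMap adj ![x, y])
    (hG : IsGenericCliqueFree G k) (hk : 2 ≤ k) {p : GlobalType Language.graph U 1}
    (hp : ∀ b, p.Contains (notAdj b)) {l : ℕ} (b : Fin l → U)
    {ψ : Language.graph[[U]].Formula (Fin 1)}
    (h : ∀ a : Fin 1 → U, (∀ j, a 0 ≠ b j ∧ ¬ G.Adj (a 0) (b j)) → ψ.Realize a) :
    p.Contains ψ := by
  -- `x ≠ b` follows from `¬ E(x, c)` for a neighbour `c` of `b`
  choose c hc using fun j => hG.exists_adj_self hk (b j)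
  have hconj : p.Contains (Formula.iInf fun j => notAdj (b j) ⊓ notAdj (c j)) := by
    obtain ⟨N, v, hN⟩ := p.exists_realize
    simp only [hN, Formula.realize_iInf, Formula.realize_inf] at hp ⊢
    exact fun j => ⟨hp _, hp _⟩
  refine hconj.mono fun a ha => h a fun j => ?_
  simp only [Formula.realize_iInf, Formula.realize_inf, realize_notAdj hadj] at ha
  exact ⟨fun e => (ha j).2 (e ▸ hc j), (ha j).1⟩

theorem contains_iff_of_apart (hadj : ∀ x y, G.Adj x y ↔ Structure.RelMap adj ![x, y])
    (hG : IsGenericCliqueFree G k) (hk : 2 ≤ k) {p : GlobalType Language.graph U 1}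
    (hp : ∀ b, p.Contains (notAdj b)) {l : ℕ} (φ : Language.graph.Formula (Fin 1 ⊕ Fin l))
    (b : Fin l → U) {a : Fin 1 → U} (ha : ∀ j, a 0 ≠ b j ∧ ¬ G.Adj (a 0) (b j)) :
    p.Contains (instParams φ b) ↔ φ.Realize (Sum.elim a b) := by
  have key : ∀ φ : Language.graph.Formula (Fin 1 ⊕ Fin l), φ.Realize (Sum.elim a b) →
      p.Contains (instParams φ b) := fun φ hφ =>
    contains_of_forall_apart hadj hG hk hp b fun a' ha' => by
      rw [realize_instParams]
      exact (hG.realize_iff_of_apart hadj φ ha ha').1 hφ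
  refine ⟨fun h => ?_, key φ⟩
  by_contra hφ
  refine (p.contains_not_iff _).1 ((key φ.not hφ).mono fun a' ha' => ?_) h
  rw [realize_instParams, Formula.realize_not] at ha'
  rwa [Formula.realize_not, realize_instParams]

open scoped Classical in
/-- Types containing all `¬ E(x, b)` are equal. -/
theorem eq_of_contains_notAdj (hadj : ∀ x y, G.Adj x y ↔ Structure.RelMap adj ![x, y])
    (hG : IsGenericCliqueFree G k) (hk : 2 ≤ k) {p q : GlobalType Language.graph U 1}
    (hp : ∀ b, p.Contains (notAdj b)) (hq : ∀ b, q.Contains (notAdj b)) : p = q := by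
  refine GlobalType.ext_contains fun ψ => ?_
  obtain ⟨l, φ, b, hψ⟩ := exists_instParams ψ
  obtain ⟨a, ha⟩ := hG.exists_apart (by omega) (Finset.univ.image b)
  have ha' : ∀ j, (fun _ => a : Fin 1 → U) 0 ≠ b j ∧ ¬ G.Adj ((fun _ => a : Fin 1 → U) 0) (b j) :=
    fun j => ha _ (Finset.mem_image_of_mem b (Finset.mem_univ j))
  have e : ∀ p : GlobalType Language.graph U 1, p.Contains ψ ↔ p.Contains (instParams φ b) :=
    fun p => ⟨fun h => h.mono fun a => (hψ a).1, fun h => h.mono fun a => (hψ a).2⟩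
  rw [e, e, contains_iff_of_apart hadj hG hk hp φ b (a := fun _ => a) ha',
    contains_iff_of_apart hadj hG hk hq φ b (a := fun _ => a) ha']

/-- A type containing all `¬ E(x, b)` exists, as a limit point of types of vertices. -/
theorem exists_contains_notAdj [Nonempty U]
    (hadj : ∀ x y, G.Adj x y ↔ Structure.RelMap adj ![x, y])
    (hG : IsGenericCliqueFree G k) (hk : 1 ≤ k) :
    ∃ p : GlobalType Language.graph U 1, ∀ b, p.Contains (notAdj b) := by
  choose a ha using hG.exists_apart hk
  obtain ⟨p, hp⟩ := exists_clusterPt_of_compactSpace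
    (map (fun B : Finset U => tp (L := Language.graph) (fun _ : Fin 1 => a B)) atTop)
  refine ⟨p, fun b => ?_⟩
  by_contra hb
  rw [← GlobalType.contains_not_iff] at hb
  have h1 := MapClusterPt.frequently hp ((isOpen_contains _).mem_nhds hb)
  refine h1 ((eventually_ge_atTop {b}).mono fun B hB h => ?_)
  simp only [tp_contains, Formula.realize_not, realize_notAdj hadj, not_not] at h
  exact (ha B b (hB (Finset.mem_singleton_self b))).2 h

theorem not_isRealized_of_contains_notAdj [Nonempty U]
    (hadj : ∀ x y, G.Adj x y ↔ Structure.RelMap adj ![x, y])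
    (hG : IsGenericCliqueFree G k) (hk : 2 ≤ k) {p : GlobalType Language.graph U 1}
    (hp : ∀ b, p.Contains (notAdj b)) : ¬ p.IsRealized := by
  rintro ⟨a, rfl⟩
  obtain ⟨c, hc⟩ := hG.exists_adj_self hk (a 0)
  exact (realize_notAdj hadj c a).1 ((tp_contains _ _).1 (hp c)) hc

open scoped Classical in
/-- The average of a sequence that meets every closed neighbourhood with density at most `ε`
approximates the Dirac measure of the type of a vertex adjacent to nothing, with an error
proportional to the number of parameters. -/
theorem abs_dirac_sub_average_le (hadj : ∀ x y, G.Adj x y ↔ Structure.RelMap adj ![x, y])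
    (hG : IsGenericCliqueFree G k) (hk : 2 ≤ k) {p : GlobalType Language.graph U 1}
    (hp : ∀ b, p.Contains (notAdj b)) {m : ℕ} (a : Fin (m + 1) → Fin 1 → U) {ε : ℝ}
    (ha : ∀ b, ((Finset.univ.filter fun i => a i 0 = b ∨ G.Adj (a i 0) b).card : ℝ) ≤
      ε * (m + 1 : ℕ)) {l : ℕ} (φ : Language.graph.Formula (Fin 1 ⊕ Fin l)) (b : Fin l → U) :
    |dirac p (instParams φ b) - average (L := Language.graph) a (instParams φ b)| ≤ l * ε := by
  have hm : (0 : ℝ) < (m + 1 : ℕ) := by positivity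
  -- the terms of the sequence that are not apart from `b`
  set D : Finset (Fin (m + 1)) :=
    Finset.univ.biUnion fun j => Finset.univ.filter fun i => a i 0 = b j ∨ G.Adj (a i 0) (b j)
  have hD : (D.card : ℝ) ≤ l * ε * (m + 1 : ℕ) := by
    calc (D.card : ℝ) ≤ ∑ j, ((Finset.univ.filter fun i =>
          a i 0 = b j ∨ G.Adj (a i 0) (b j)).card : ℝ) := by exact_mod_cast Finset.card_biUnion_le
      _ ≤ ∑ _j : Fin l, ε * (m + 1 : ℕ) := Finset.sum_le_sum fun j _ => ha _
      _ = _ := by rw [Finset.sum_const, Finset.card_univ, Fintype.card_fin, nsmul_eq_mul, mul_assoc]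
  have hgood : ∀ i ∉ D, (p.Contains (instParams φ b) ↔ (instParams φ b).Realize (a i)) := by
    intro i hi
    rw [realize_instParams]
    refine contains_iff_of_apart hadj hG hk hp φ b fun j => ?_
    rw [← not_or]
    exact fun h => hi (Finset.mem_biUnion.2 ⟨j, Finset.mem_univ _, by simpa using h⟩)
  set R := Finset.univ.filter fun i => (instParams φ b).Realize (a i)
  have hav : average (L := Language.graph) a (instParams φ b) = (R.card : ℝ) / (m + 1 : ℕ) := rfl
  have hdi : dirac p (instParams φ b) = if p.Contains (instParams φ b) then 1 else 0 := rfl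
  rw [hav, hdi]
  by_cases hc : p.Contains (instParams φ b)
  · have h1 : Rᶜ ⊆ D := by
      intro i hi
      by_contra hiD
      exact Finset.mem_compl.1 hi (by simpa [R] using (hgood i hiD).1 hc)
    have h2 : (R.card : ℝ) + Rᶜ.card = (m + 1 : ℕ) := by
      exact_mod_cast (Finset.card_add_card_compl R).trans (Fintype.card_fin _)
    have h3 : (Rᶜ.card : ℝ) ≤ D.card := by exact_mod_cast Finset.card_le_card h1
    have h4 : (1 : ℝ) - R.card / (m + 1 : ℕ) = Rᶜ.card / (m + 1 : ℕ) := by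
      rw [← h2] at hm ⊢
      field_simp
      ring
    rw [if_pos hc, h4, abs_of_nonneg (by positivity), div_le_iff₀ hm]
    exact h3.trans hD
  · have h1 : R ⊆ D := by
      intro i hi
      by_contra hiD
      exact hc ((hgood i hiD).2 (by simpa [R] using hi))
    have h3 : (R.card : ℝ) ≤ D.card := by exact_mod_cast Finset.card_le_card h1
    rw [if_neg hc, zero_sub, abs_neg, abs_of_nonneg (by positivity), div_le_iff₀ hm]
    exact h3.trans hD

open scoped Classical in
/-- In an elementary substructure there are finite sequences that meet every closed neighbourhood
of a vertex of `U` with arbitrarily small density. -/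
theorem exists_sparse_of_elementarySubstructure
    (hadj : ∀ x y, G.Adj x y ↔ Structure.RelMap adj ![x, y]) (hG : IsGenericCliqueFree G k)
    (hk : 1 ≤ k) (hU : U ⊨ randomCliqueFreeGraph (k + 1))
    (M : Language.graph.ElementarySubstructure U) {ε : ℝ} (hε : 0 < ε) :
    ∃ (m : ℕ) (a : Fin (m + 1) → Fin 1 → U), (∀ i j, a i j ∈ M) ∧
      ∀ b, ((Finset.univ.filter fun i => a i 0 = b ∨ G.Adj (a i 0) b).card : ℝ) ≤
        ε * (m + 1 : ℕ) := by
  obtain ⟨GM, hadjM, hGM⟩ := exists_isGenericCliqueFree (V := M)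
    ((M.theory_model_iff (randomCliqueFreeGraph (k + 1))).2 hU)
  have hGMG : ∀ x y : M, GM.Adj x y ↔ G.Adj x y := by
    intro x y
    rw [hadjM, hadj, ← M.subtype.map_rel adj ![x, y] ]
    refine iff_of_eq (congrArg _ (funext fun i => ?_))
    fin_cases i <;> rfl
  obtain ⟨m, a, hinj, hm, hS⟩ := hGM.exists_sparse hk (half_pos hε)
  refine ⟨m, fun i _ => a i, fun i _ => (a i).2, fun b => ?_⟩
  have h1 : ((Finset.univ.filter fun i => (a i : U) = b).card : ℝ) ≤ ε / 2 * (m + 1 : ℕ) := by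
    refine le_trans ?_ hm
    have : (Finset.univ.filter fun i => (a i : U) = b).card ≤ 1 := by
      refine Finset.card_le_one.2 fun i hi j hj => hinj (Subtype.ext ?_)
      rw [(Finset.mem_filter.1 hi).2, (Finset.mem_filter.1 hj).2]
    exact_mod_cast this
  have h2 := hS {v : M | G.Adj b v} (by
    have := cliqueFreeOn_of_forall_adj (S := G.neighborSet b) hG.cliqueFree fun a ha => ha
    rw [cliqueFreeOn_iff_forall_fun] at this ⊢
    exact fun f hf hfadj => this (fun i => f i) hf fun i j hij => (hGMG _ _).1 (hfadj i j hij))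
  have h3 : (Finset.univ.filter fun i => (a i : U) = b ∨ G.Adj (a i) b).card ≤
      (Finset.univ.filter fun i => (a i : U) = b).card +
        (Finset.univ.filter fun i => a i ∈ {v : M | G.Adj b v}).card := by
    rw [Finset.filter_or]
    refine (Finset.card_union_le _ _).trans (Nat.add_le_add_left (Finset.card_le_card ?_) _)
    intro i hi
    simpa [G.adj_comm] using hi
  calc ((Finset.univ.filter fun i => (a i : U) = b ∨ G.Adj (a i) b).card : ℝ)
      ≤ (Finset.univ.filter fun i => (a i : U) = b).card +
        (Finset.univ.filter fun i => a i ∈ {v : M | G.Adj b v}).card := by exact_mod_cast h3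
    _ ≤ ε * (m + 1 : ℕ) := by linarith

theorem isFinitelyApproximatedOver_dirac
    (hadj : ∀ x y, G.Adj x y ↔ Structure.RelMap adj ![x, y]) (hG : IsGenericCliqueFree G k)
    (hk : 2 ≤ k) (hU : U ⊨ randomCliqueFreeGraph (k + 1)) {p : GlobalType Language.graph U 1}
    (hp : ∀ b, p.Contains (notAdj b)) (M : Language.graph.ElementarySubstructure U) :
    (dirac p).IsFinitelyApproximatedOver M := by
  intro l φ ε hε
  obtain ⟨m, a, haM, ha⟩ := exists_sparse_of_elementarySubstructure hadj hG (by omega) hU M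
    (show 0 < ε / (l + 1) by positivity)
  refine ⟨m, a, haM, fun b => (abs_dirac_sub_average_le hadj hG hk hp a ha φ b).trans_lt ?_⟩
  rw [mul_div_assoc', div_lt_iff₀ (by positivity)]
  nlinarith

theorem isSequentiallyApproximatedOver_dirac
    (hadj : ∀ x y, G.Adj x y ↔ Structure.RelMap adj ![x, y]) (hG : IsGenericCliqueFree G k)
    (hk : 2 ≤ k) (hU : U ⊨ randomCliqueFreeGraph (k + 1)) {p : GlobalType Language.graph U 1}
    (hp : ∀ b, p.Contains (notAdj b)) (M : Language.graph.ElementarySubstructure U) :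
    (dirac p).IsSequentiallyApproximatedOver M := by
  choose m a haM ha using fun t : ℕ => exists_sparse_of_elementarySubstructure hadj hG (by omega) hU
    M (show (0 : ℝ) < 1 / ((t : ℝ) + 1) by positivity)
  refine ⟨m, a, haM, ?_⟩
  rw [nhds_induced, tendsto_comap_iff, tendsto_pi_nhds]
  intro ψ
  obtain ⟨l, φ, b, hψ⟩ := exists_instParams ψ
  simp only [Function.comp_apply, KeislerMeasure.congr' _ _ _ hψ]
  rw [tendsto_iff_dist_tendsto_zero]
  have hlim := (tendsto_one_div_add_atTop_nhds_zero_nat (𝕜 := ℝ)).const_mul (l : ℝ)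
  rw [mul_zero] at hlim
  refine squeeze_zero (fun _ => dist_nonneg) (fun t => ?_) hlim
  rw [dist_comm, Real.dist_eq]
  exact abs_dirac_sub_average_le hadj hG hk hp (a t) (ha t) φ b

theorem exists_elementarySubstructure_small [Infinite U] {κ : Cardinal} (hκ : ℵ₀ < κ) :
    ∃ M : Language.graph.ElementarySubstructure U, #M < κ := by
  have hcard : Language.graph.card ≤ ℵ₀ := by
    rw [Language.card, mk_le_aleph0_iff]
    have : ∀ l, Countable (Language.graph.Functions l) := fun l => inferInstanceAs (Countable Empty)
    unfold Language.Symbols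
    infer_instance
  obtain ⟨M, -, hM⟩ := exists_elementarySubstructure_card_eq Language.graph (M := U) ∅
    (ℵ₀ : Cardinal.{0}) le_rfl
    (by simp) (by simpa using hcard) (by simp)
  refine ⟨M, ?_⟩
  rw [lift_aleph0, lift_eq_aleph0] at hM
  rwa [hM]

end NonAdjacentType

/-! ### Limits of sequences of types of tuples -/

section Sequences

variable {U : Type*} [Language.graph.Structure U] {G : SimpleGraph U} {k : ℕ}

/-- The formula `E(x, c)`, for a parameter `c` from `A`. -/
def adjParam {A : Set U} (c : A) : Language.graph[[A]].Formula (Fin 1) :=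
  BoundedFormula.subst ((Language.graph.lhomWithConstants A).onFormula
    (adjFormula (Sum.inl 0) (Sum.inr 0) : Language.graph.Formula (Fin 1 ⊕ Fin 1)))
    (Sum.elim Term.var fun _ => Constants.term (Language.graph.con c))

theorem realize_adjParam (hadj : ∀ x y, G.Adj x y ↔ Structure.RelMap adj ![x, y]) {A : Set U}
    (c : A) (a : Fin 1 → U) : (adjParam c).Realize a ↔ G.Adj (a 0) c := by
  unfold adjParam Formula.Realize
  rw [BoundedFormula.realize_subst]
  have : (fun i : Fin 1 ⊕ Fin 1 => Term.realize a
      (Sum.elim Term.var (fun _ => Constants.term (Language.graph.con c)) i :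
        Language.graph[[A]].Term (Fin 1))) = Sum.elim a fun _ => (c : U) := by
    funext i
    cases i with
    | inl i => rfl
    | inr j => exact (Term.realize_constants).trans (by simp)
  rw [this, hadj]
  exact (LHom.realize_onFormula _ _).trans (realize_adjFormula _ _ _)

open scoped Classical in
/-- Saturation: an infinite independent sequence can be split arbitrarily by a neighbourhood. -/
theorem exists_adj_iff_of_independent
    (hadj : ∀ x y, G.Adj x y ↔ Structure.RelMap adj ![x, y]) (hG : IsGenericCliqueFree G k)
    (hk : 2 ≤ k) {κ : Cardinal} (hκ : ℵ₀ < κ) (hsat : IsSaturated Language.graph U κ)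
    {e : ℕ → U} (he : Function.Injective e) (hind : ∀ i j, ¬ G.Adj (e i) (e j)) (P : ℕ → Prop) :
    ∃ b, ∀ i, G.Adj b (e i) ↔ P i := by
  let A : Set U := Set.range e
  let γ : ℕ → Language.graph[[A]].Formula (Fin 1) := fun i =>
    if P i then adjParam (A := A) ⟨e i, i, rfl⟩ else (adjParam (A := A) ⟨e i, i, rfl⟩).not
  have hγ : ∀ i (a : Fin 1 → U), (γ i).Realize a ↔ (G.Adj (a 0) (e i) ↔ P i) := by
    intro i a
    by_cases hi : P i
    · simp only [γ, if_pos hi, realize_adjParam hadj, hi, iff_true]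
    · simp only [γ, if_neg hi, Formula.realize_not, realize_adjParam hadj, hi, iff_false]
  obtain ⟨a, ha⟩ := hsat A ((Set.countable_range e).le_aleph0.trans_lt hκ) (Set.range γ) (by
    intro Γ hΓ
    choose ix hix using fun φ : Γ => hΓ φ.2
    let I : Finset ℕ := Finset.univ.image ix
    obtain ⟨z, -, hzA, hzB⟩ := hG.exists_adj ((I.filter P).image e)
      ((I.filter fun i => ¬ P i).image e)
      ((Finset.disjoint_image he).2 (Finset.disjoint_filter_filter_not _ _ _)) (by
        rw [cliqueFreeOn_iff_forall_fun]
        intro f hf hfadj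
        have h01 : (⟨0, by omega⟩ : Fin k) ≠ ⟨1, by omega⟩ := by simp
        have h := hfadj _ _ h01
        obtain ⟨i, -, hi⟩ := Finset.mem_image.1 (hf ⟨0, by omega⟩)
        obtain ⟨j, -, hj⟩ := Finset.mem_image.1 (hf ⟨1, by omega⟩)
        rw [← hi, ← hj] at h
        exact hind i j h)
    refine ⟨fun _ => z, fun φ hφ => ?_⟩
    have hφI : ix ⟨φ, hφ⟩ ∈ I := Finset.mem_image_of_mem _ (Finset.mem_univ _)
    suffices h : (γ (ix ⟨φ, hφ⟩)).Realize fun _ => z by rwa [hix] at h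
    rw [hγ]
    by_cases hP : P (ix ⟨φ, hφ⟩)
    · exact iff_of_true
        (hzA _ (Finset.mem_image_of_mem e (Finset.mem_filter.2 ⟨hφI, hP⟩))) hP
    · exact iff_of_false
        (hzB _ (Finset.mem_image_of_mem e
          (Finset.mem_filter (p := fun i => ¬ P i).2 ⟨hφI, hP⟩))) hP)
  exact ⟨a 0, fun i => (hγ i a).1 (ha _ ⟨i, rfl⟩)⟩

/-- A sequence of vertices for which the truth values of `x = b` and `E(x, b)` converge for all `b`
is eventually constant. Otherwise it has a subsequence of distinct vertices that is a clique, which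
is impossible, or is independent, and then some vertex is adjacent to exactly every other term. -/
theorem exists_eventually_eq
    (hadj : ∀ x y, G.Adj x y ↔ Structure.RelMap adj ![x, y]) (hG : IsGenericCliqueFree G k)
    (hk : 2 ≤ k) {κ : Cardinal} (hκ : ℵ₀ < κ) (hsat : IsSaturated Language.graph U κ)
    {e : ℕ → U} (heq : ∀ b, (∀ᶠ i in atTop, e i = b) ∨ ∀ᶠ i in atTop, e i ≠ b)
    (hconv : ∀ b, (∀ᶠ i in atTop, G.Adj b (e i)) ∨ ∀ᶠ i in atTop, ¬ G.Adj b (e i)) :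
    ∃ c, ∀ᶠ i in atTop, e i = c := by
  by_contra hno
  push Not at hno
  have hne : ∀ b, ∀ᶠ i in atTop, e i ≠ b := fun b =>
    (heq b).resolve_left fun h => hno b (h.mono fun i hi => by simpa using hi)
  by_cases hK : ∃ᶠ k in atTop, ∀ᶠ i in atTop, G.Adj (e k) (e i)
  · obtain ⟨f, -, hf⟩ := exists_seq_of_forall_finset_exists
      (fun k => ∀ᶠ i in atTop, G.Adj (e k) (e i)) (fun k i => G.Adj (e k) (e i))
      fun s hs => (hK.and_eventually ((s.eventually_all).2 hs)).exists
    refine cliqueFree_iff_forall_fun.1 hG.cliqueFree (fun i => e (f i)) fun i j hij => ?_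
    rcases lt_or_gt_of_ne hij with h | h
    · exact hf _ _ h
    · exact (hf _ _ h).symm
  · have hK' : ∀ᶠ k in atTop, ∀ᶠ i in atTop, ¬ G.Adj (e k) (e i) :=
      (not_frequently.1 hK).mono fun k hk => (hconv (e k)).resolve_left hk
    obtain ⟨f, -, hf⟩ := exists_seq_of_forall_finset_exists
      (fun k => ∀ᶠ i in atTop, ¬ G.Adj (e k) (e i))
      (fun k i => k < i ∧ e i ≠ e k ∧ ¬ G.Adj (e k) (e i))
      fun s hs => (hK'.and ((s.eventually_all).2 fun x hx =>
        (eventually_gt_atTop x).and ((hne (e x)).and (hs x hx)))).exists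
    have hmono : StrictMono f := fun i j hij => (hf i j hij).1
    obtain ⟨b, hb⟩ := exists_adj_iff_of_independent hadj hG hk hκ hsat (e := e ∘ f)
      (fun i j hij => by
        by_contra h
        rcases lt_or_gt_of_ne h with h | h
        · exact (hf _ _ h).2.1 hij.symm
        · exact (hf _ _ h).2.1 hij)
      (fun i j h => by
        rcases lt_trichotomy i j with hij | rfl | hij
        · exact (hf _ _ hij).2.2 h
        · exact G.irrefl h
        · exact (hf _ _ hij).2.2 h.symm) Even
    rcases hconv b with h | h
    · obtain ⟨N, hN⟩ := eventually_atTop.1 (hmono.tendsto_atTop.eventually h)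
      exact absurd ((hb (2 * N + 1)).1 (hN _ (by omega))) (by simp)
    · obtain ⟨N, hN⟩ := eventually_atTop.1 (hmono.tendsto_atTop.eventually h)
      exact hN (2 * N) (by omega) ((hb (2 * N)).2 (by simp))

theorem isRealized_of_tendsto [Nonempty U]
    (hadj : ∀ x y, G.Adj x y ↔ Structure.RelMap adj ![x, y]) (hG : IsGenericCliqueFree G k)
    (hk : 2 ≤ k) {κ : Cardinal} (hκ : ℵ₀ < κ) (hsat : IsSaturated Language.graph U κ)
    {n : ℕ} {p : GlobalType Language.graph U n} {a : ℕ → Fin n → U}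
    (h : Tendsto (fun i => tp (L := Language.graph) (a i)) atTop (𝓝 p)) : p.IsRealized := by
  have hdec : ∀ φ : Language.graph[[U]].Formula (Fin n),
      (∀ᶠ i in atTop, φ.Realize (a i)) ∨ ∀ᶠ i in atTop, ¬ φ.Realize (a i) := by
    intro φ
    have := eventually_realize_iff h φ
    by_cases hp : p.Contains φ
    · exact Or.inl (this.mono fun i hi => hi.2 hp)
    · exact Or.inr (this.mono fun i hi hr => hp (hi.1 hr))
  refine GlobalType.isRealized_of_eventually_eq h fun j =>
    exists_eventually_eq hadj hG hk hκ hsat (fun b => ?_) fun b => ?_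
  · simpa only [realize_instParams, realize_eqFormula, Sum.elim_inl, Sum.elim_inr] using hdec
      (instParams (eqFormula (Sum.inl j) (Sum.inr 0) : Language.graph.Formula (Fin n ⊕ Fin 1))
        fun _ => b)
  · simpa only [realize_instParams, realize_adjFormula, Sum.elim_inl, Sum.elim_inr, ← hadj] using
      hdec (instParams (adjFormula (Sum.inr 0) (Sum.inl j) :
        Language.graph.Formula (Fin n ⊕ Fin 1)) fun _ => b)

end Sequences

end KeislerMeasures

theorem mainTheorem7 (s : ℕ) (hs : 3 ≤ s)
    (U : Type*) [FirstOrder.Language.graph.Structure U] [Nonempty U]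
    (hU : U ⊨ KeislerMeasures.randomCliqueFreeGraph s)
    (κ : Cardinal) (hκ : ℵ₀ < κ) (hsat : KeislerMeasures.IsSaturated FirstOrder.Language.graph U κ) :
    (∃ p : KeislerMeasures.GlobalType FirstOrder.Language.graph U 1,
      -- `p` is the unique global type containing all the formulas `¬ E(x, b)`
      (∀ q : KeislerMeasures.GlobalType FirstOrder.Language.graph U 1,
        (∀ b : U, q.Contains (KeislerMeasures.notAdj b)) ↔ q = p) ∧
      (∀ M : FirstOrder.Language.graph.ElementarySubstructure U,
        (KeislerMeasures.dirac p).IsFinitelyApproximatedOver M) ∧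
      (KeislerMeasures.dirac p).IsFinitelyApproximated κ ∧
      (KeislerMeasures.dirac p).IsSequentiallyApproximated κ ∧
      ¬ p.IsSequentiallyApproximated κ) ∧
    (∀ (n : ℕ) (p : KeislerMeasures.GlobalType FirstOrder.Language.graph U n),
      ¬ p.IsRealized → ¬ p.IsSequentiallyApproximated κ) := by
  obtain ⟨k, rfl⟩ : ∃ k, s = k + 1 := ⟨s - 1, by omega⟩
  have hk : 2 ≤ k := by omega
  obtain ⟨G, hadj, hG⟩ := KeislerMeasures.exists_isGenericCliqueFree hU
  have hseq : ∀ (n : ℕ) (p : KeislerMeasures.GlobalType FirstOrder.Language.graph U n),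
      ¬ p.IsRealized → ¬ p.IsSequentiallyApproximated κ := by
    rintro n p hp ⟨M, -, a, -, ha⟩
    exact hp (KeislerMeasures.isRealized_of_tendsto hadj hG hk hκ hsat ha)
  obtain ⟨p, hp⟩ := KeislerMeasures.exists_contains_notAdj hadj hG (by omega)
  have := hG.infinite (by omega)
  obtain ⟨M, hM⟩ := KeislerMeasures.exists_elementarySubstructure_small (U := U) hκ
  have hfin := KeislerMeasures.isFinitelyApproximatedOver_dirac hadj hG hk hU hp
  refine ⟨⟨p, fun q => ⟨fun hq => ?_, fun hq => hq ▸ hp⟩, hfin, ⟨M, hM, hfin M⟩, ⟨M, hM, ?_⟩, ?_⟩,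
    hseq⟩
  · exact KeislerMeasures.eq_of_contains_notAdj hadj hG hk hq hp
  · exact KeislerMeasures.isSequentiallyApproximatedOver_dirac hadj hG hk hU hp M
  · exact hseq 1 p (KeislerMeasures.not_isRealized_of_contains_notAdj hadj hG hk hp)
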